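/- Let $d,m\ge 1$, $r>0$, $T>0$, and write $|\cdot|$ for Euclidean norms. For $s<t$ let $W_0^{\alpha,\infty}(s,t;\mathbb R^d)$ be the space of measurable $f:[s,t]\to\mathbb R^d$ with $$\sup_{u\in[s,t]}\Big(|f(u)|+\int_s^u\frac{|f(u)-f(v)|}{(u-v)^{\alpha+1}}\,dv\Big)<\infty ,$$ and let $W_0^{\alpha,\infty}(s,t;\mathbb R^d_+)$ be its subset of functions with values in $\mathbb R^d_+=\{u\in\mathbb R^d: u_i\ge 0 \text{ for all } i\}$. Let $W_T^{1-\alpha,\infty}(0,T;\mathbb R^m)$ be the space of measurable $g:[0,T]\to\mathbb R^m$ with $$\sup_{0<s<t<T}\Big(\frac{|g(t)-g(s)|}{(t-s)^{1-\alpha}}+\int_s^t\frac{|g(y)-g(s)|}{(y-s)^{2-\alpha}}\,dy\Big)<\infty .$$ For real-valued $f,g$, $\int_0^t f\,dg$ denotes Zähle's generalized Stieltjes integral $$\int_0^t f\,dg=(-1)^\alpha\int_0^t D^\alpha_{0+}f(s)\,D^{1-\alpha}_{t-}g_{t-}(s)\,ds,\qquad g_{t-}(s)=g(s)-g(t-),\quad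 (-1)^\alpha=e^{i\pi\alpha},$$ where, for $0<\gamma<1$ and $0<s<t$, $$D^{\gamma}_{0+}f(s)=\tfrac1{\Gamma(1-\gamma)}\Big(\tfrac{f(s)}{s^\gamma}+\gamma\int_0^s\tfrac{f(s)-f(y)}{(s-y)^{\gamma+1}}dy\Big),\qquad D^{\gamma}_{t-}h(s)=\tfrac{(-1)^\gamma}{\Gamma(1-\gamma)}\Big(\tfrac{h(s)}{(t-s)^\gamma}+\gamma\int_s^t\tfrac{h(s)-h(y)}{(y-s)^{\gamma+1}}dy\Big);$$ for matrix-valued $f$ and vector-valued $g$, $\big(\int_0^t f\,dg\big)^i=\sum_j\int_0^t f_{ij}\,dg^j$. Assume: (H1) $\sigma:[0,T]\times\mathbb R^d\to\mathbb R^{d\times m}$ is measurable and there are $\beta>0$, $M_0>0$ with $|\sigma(t,x)-\sigma(t,y)|\le M_0|x-y|$ and $|\sigma(t,x)-\sigma(s,x)|\le M_0|t-s|^\beta$ for all $s,t\in[0,T]$, $x,y\in\mathbb R^d$. (H2) with exponent $\rho$: $b:[0,T]\times C([-r,T];\mathbb R^d)\to\mathbb R^d$ is measurable; for $t\in(0,T]$,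 $b(t,f)$ depends only on $f|_{[-r,t]}$; $\rho\ge2$, and there are a real-valued $b_0\in L^\rho(0,T)$ and constants $L_N>0$ ($N\ge0$) such that, for all $t\in[0,T]$, $|b(t,x)-b(t,y)|\le L_N\sup_{-r\le s\le t}|x(s)-y(s)|$ whenever $\|x\|_\infty,\|y\|_\infty\le N$, and $|b(t,x)|\le L_0\sup_{-r\le s\le t}|x(s)|+b_0(t)$ for all $x$. **Theorem (deterministic existence and uniqueness).** Let $\sigma$ satisfy (H1), let $0<\alpha<\min\{\tfrac12,\beta\}$, and let $b$ satisfy (H2) with $\rho=1/\alpha$. Let $g\in W_T^{1-\alpha,\infty}(0,T;\mathbb R^m)$ and let $\eta\in W_0^{\alpha,\infty}(-r,0;\mathbb R^d_+)$ be continuous. Then there is exactly one continuous $x:[-r,T]\to\mathbb R^d$ in $W_0^{\alpha,\infty}(-r,T;\mathbb R^d_+)$ such that $x(t)=\eta(t)$ for $t\in[-r,0]$ and $$x(t)=z(t)+y(t),\quad t\in(0,T],\qquad z(t)=\eta(0)+\int_0^t b(s,x)\,ds+\int_0^t\sigma(s,x(s-r))\,dg_s,\quad t\in[0,T],$$ where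 $y^i(t)=\max_{0\le s\le t}(z^i(s))^-$ with $a^-=\max(-a,0)$, for $t\in[0,T]$ and $i=1,\dots,d$. -/

import Mathlib

open MeasureTheory Set
open scoped ENNReal Matrix.Norms.Frobenius

noncomputable section

/-- `ℝ^d` with the Euclidean norm. -/
abbrev Vec (d : ℕ) : Type := EuclideanSpace ℝ (Fin d)

/-- The space `C(s, t; ℝ^d)` of continuous paths, with the uniform norm. -/
abbrev PathSpace (s t : ℝ) (d : ℕ) : Type := C(Icc s t, Vec d)

/-- The norm `sup_{u ∈ [s,t]} (|f u| + ∫_s^u |f u - f v| / (u - v)^(α+1) dv)`, as an extended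
nonnegative number. -/
def normAlphaInf {F : Type*} [NormedAddCommGroup F] (α s t : ℝ) (f : ℝ → F) : ℝ≥0∞ :=
  ⨆ u ∈ Icc s t,
    (‖f u‖ₑ + ∫⁻ v in Ioo s u, ‖f u - f v‖ₑ / ENNReal.ofReal ((u - v) ^ (α + 1)))

/-- Membership in `W_0^{α,∞}(s, t; ℝ^d)`; only the values of `f` on `[s,t]` matter. -/
structure MemW0 {d : ℕ} (α s t : ℝ) (f : ℝ → Vec d) : Prop where
  measurable : Measurable ((Icc s t).domRestrict f)
  norm_lt_top : normAlphaInf α s t f < ∞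

/-- The quantity
`sup_{0<s<t<T} (|g t - g s| / (t-s)^(1-α) + ∫_s^t |g y - g s| / (y - s)^(2-α) dy)`,
as an extended nonnegative number. -/
def normOneSubAlphaInf {F : Type*} [NormedAddCommGroup F] (α T : ℝ) (g : ℝ → F) : ℝ≥0∞ :=
  ⨆ s ∈ Ioo 0 T, ⨆ t ∈ Ioo s T,
    (‖g t - g s‖ₑ / ENNReal.ofReal ((t - s) ^ (1 - α))
      + ∫⁻ y in Ioo s t, ‖g y - g s‖ₑ / ENNReal.ofReal ((y - s) ^ (2 - α)))

/-- Membership in `W_T^{1-α,∞}(0, T; ℝ^m)`; only the values of `g` on `[0,T]` matter. -/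
structure MemWT {m : ℕ} (α T : ℝ) (g : ℝ → Vec m) : Prop where
  measurable : Measurable ((Icc 0 T).domRestrict g)
  norm_lt_top : normOneSubAlphaInf α T g < ∞

/-- The left-sided fractional (Weyl) derivative `D^α_{a+} f`, at a point `x > a`. -/
def weylDerivLeft (α a : ℝ) (f : ℝ → ℝ) (x : ℝ) : ℝ :=
  1 / Real.Gamma (1 - α) *
    (f x / (x - a) ^ α + α * ∫ y in a..x, (f x - f y) / (x - y) ^ (α + 1))

/-- The right-sided fractional (Weyl) derivative at a point `x < b`, without its complex
factor: `D^α_{b-} g = (-1)^α * weylDerivRight α b g`, where `(-1)^α = exp (i π α)`. -/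
def weylDerivRight (α b : ℝ) (g : ℝ → ℝ) (x : ℝ) : ℝ :=
  1 / Real.Gamma (1 - α) *
    (g x / (b - x) ^ α + α * ∫ y in x..b, (g x - g y) / (y - x) ^ (α + 1))

/-- Zähle's generalized Stieltjes integral
`∫_a^b f dg = (-1)^α ∫_a^b (D^α_{a+} f)(x) (D^{1-α}_{b-} g_{b-})(x) dx`, with
`g_{b-} x = g x - g (b-)`. The two complex factors multiply to `(-1)^α (-1)^(1-α) = -1`. -/
def fracStieltjes (α a b : ℝ) (f g : ℝ → ℝ) : ℝ :=
  -∫ x in a..b,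
    weylDerivLeft α a f x * weylDerivRight (1 - α) b (fun u => g u - Function.leftLim g b) x

/-- `∫_a^b f dg` for a matrix-valued `f` and a vector-valued `g`; the `i`-th component is
`∑_j ∫_a^b f_{ij} dg^j`. -/
def fracStieltjesVec {d m : ℕ} (α a b : ℝ) (f : ℝ → Matrix (Fin d) (Fin m) ℝ) (g : ℝ → Vec m) :
    Vec d :=
  WithLp.toLp 2 fun i => ∑ j, fracStieltjes α a b (fun s => f s i j) (fun s => g s j)

/-- `sup_{s ≤ u ≤ τ} |x u|` for a continuous path `x` on `[s,t]`. -/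
def supNormUpTo {s t : ℝ} {d : ℕ} (τ : ℝ) (x : PathSpace s t d) : ℝ :=
  sSup ((fun u => ‖x u‖) '' {u : Icc s t | (u : ℝ) ≤ τ})

/-- Hypothesis (H1) on `σ : [0,T] × ℝ^d → ℝ^{d×m}`: measurable, Lipschitz in space, `β`-Hölder in
time. Matrices carry the Euclidean (Frobenius) norm. -/
structure HypH1 {d m : ℕ} (T β : ℝ) (σ : ℝ → Vec d → Matrix (Fin d) (Fin m) ℝ) : Prop where
  beta_pos : 0 < β
  measurable : ∀ i j, Measurable fun p : Icc (0 : ℝ) T × Vec d => σ p.1 p.2 i j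
  bounds : ∃ M₀ : ℝ, 0 < M₀ ∧
    (∀ t ∈ Icc 0 T, ∀ x y, ‖σ t x - σ t y‖ ≤ M₀ * ‖x - y‖) ∧
    (∀ t ∈ Icc 0 T, ∀ s ∈ Icc 0 T, ∀ x, ‖σ t x - σ s x‖ ≤ M₀ * |t - s| ^ β)

/-- Hypothesis (H2) on `b : [0,T] × C(-r,T;ℝ^d) → ℝ^d` with integrability exponent `ρ`: measurable
(for the Borel σ-algebras), nonanticipating, locally Lipschitz and of linear growth up to a
function `b₀` in `L^ρ(0,T)`. -/
structure HypH2 {d : ℕ} (r T ρ : ℝ) (b : ℝ → PathSpace (-r) T d → Vec d) : Prop where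
  two_le : 2 ≤ ρ
  measurable :
    letI : MeasurableSpace (PathSpace (-r) T d) := borel _
    Measurable fun p : Icc (0 : ℝ) T × PathSpace (-r) T d => b p.1 p.2
  nonanticipating : ∀ t ∈ Ioc 0 T, ∀ f f' : PathSpace (-r) T d,
    (∀ s : Icc (-r) T, (s : ℝ) ≤ t → f s = f' s) → b t f = b t f'
  bounds : ∃ (b₀ : ℝ → ℝ) (L : ℝ → ℝ),
    MemLp b₀ (ENNReal.ofReal ρ) (volume.restrict (Icc 0 T)) ∧
    (∀ N, 0 ≤ N → 0 < L N) ∧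
    (∀ N, 0 ≤ N → ∀ x y : PathSpace (-r) T d, ‖x‖ ≤ N → ‖y‖ ≤ N → ∀ t ∈ Icc 0 T,
      ‖b t x - b t y‖ ≤ L N * supNormUpTo t (x - y)) ∧
    (∀ x : PathSpace (-r) T d, ∀ t ∈ Icc 0 T, ‖b t x‖ ≤ L 0 * supNormUpTo t x + b₀ t)

/-- The reflector
`z t = η 0 + ∫_0^t b(s, x) ds + ∫_0^t σ(s, x(s - r)) dg_s`. -/
def reflector {d m : ℕ} {r T : ℝ} (hrT : -r ≤ T) (α : ℝ)
    (σ : ℝ → Vec d → Matrix (Fin d) (Fin m) ℝ) (b : ℝ → PathSpace (-r) T d → Vec d)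
    (g : ℝ → Vec m) (η : ℝ → Vec d) (x : PathSpace (-r) T d) (t : ℝ) : Vec d :=
  η 0 + (∫ s in (0 : ℝ)..t, b s x)
    + fracStieltjesVec α 0 t (fun s => σ s (IccExtend hrT x (s - r))) g

/-- `y` is the regulator of `z` on `[0,T]`: `y^i t = max_{s ∈ [0,t]} (z^i s)^-`. -/
def IsRegulator {d : ℕ} (T : ℝ) (z y : ℝ → Vec d) : Prop :=
  ∀ t ∈ Icc 0 T, ∀ i, IsGreatest ((fun s => max (-(z s i)) 0) '' Icc 0 t) (y t i)

/-- `x` solves the delay equation with normal reflection: `x = η` on `[-r,0]`, and `x = z + y` on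
`(0,T]`, where `z` is the reflector of `x` and `y` the regulator of `z`. -/
structure IsReflectedDelaySolution {d m : ℕ} {r T : ℝ} (hrT : -r ≤ T) (α : ℝ)
    (σ : ℝ → Vec d → Matrix (Fin d) (Fin m) ℝ) (b : ℝ → PathSpace (-r) T d → Vec d)
    (g : ℝ → Vec m) (η : ℝ → Vec d) (x : PathSpace (-r) T d) : Prop where
  initial : ∀ t : Icc (-r) T, (t : ℝ) ≤ 0 → x t = η t
  equation : ∃ y : ℝ → Vec d, IsRegulator T (reflector hrT α σ b g η x) y ∧
    ∀ t : Icc (-r) T, 0 < (t : ℝ) → x t = reflector hrT α σ b g η x t + y t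

end

noncomputable section

open Filter Topology

/-! The delay decouples the rough integral from the unknown: up to time `τ + r` the forcing `∫ σ(s,
x(s - r)) dg` depends on `x` only up to time `τ`. So the delayed argument is frozen at a known path
in `W_0^{α,∞}`, the resulting equation is solved on all of `[0,T]`, and the solution becomes the
next frozen path. If two frozen paths agree up to `n * r`, their forcings agree up to `(n + 1) * r`,
and so do the solutions. After `N ≥ T / r` rounds the frozen path and its solution coincide, which
gives existence; the same induction gives uniqueness (`delayForcing_congr`,
`IsReflectedImage.eq_of_forcing_eq`).

With a continuous forcing, the equation is an ordinary reflected one. The regulator is Lipschitz for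
the running supremum, with constant `d`, so Picard iteration of the drift has the usual factorial
bounds. Linear growth keeps the iterates in an exponentially weighted ball, where one local
Lipschitz constant suffices (`HypH2.exists_isReflectedImage_self`).

The iteration stays in `W_0^{α,∞}` for the following reasons. Since `α < β`, composing `σ` with a
shifted `W_0^{α,∞}` path keeps the fractional bounds, and the integral of such a function against
`g` is `(1-α)`-Hölder in its upper endpoint (`exists_holder_fracStieltjes`). The drift integral is
`(1-α)`-Hölder because `b₀ ∈ L^{1/α}`, and the regulator preserves moduli of continuity up to the
factor `d`. Finally `α < 1/2` gives `1 - α > α`, so such a path, glued to `η`, lies in `W_0^{α,∞}`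
again (`memW0_of_holder`). -/

/-! ### Measurability and pointwise bounds for the Weyl derivatives. -/

theorem measurable_intervalIntegral_of_uncurry {F : ℝ → ℝ → ℝ} (hF : Measurable (Function.uncurry F))
    {a b : ℝ → ℝ} (ha : Measurable a) (hb : Measurable b) :
    Measurable fun x => ∫ y in a x..b x, F x y := by
  have key : ∀ {a b : ℝ → ℝ}, Measurable a → Measurable b →
      Measurable fun x => ∫ y in Ioc (a x) (b x), F x y := by
    intro a b ha hb
    have hS : MeasurableSet {p : ℝ × ℝ | a p.1 < p.2 ∧ p.2 ≤ b p.1} :=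
      (measurableSet_lt (ha.comp measurable_fst) measurable_snd).inter
        (measurableSet_le measurable_snd (hb.comp measurable_fst))
    have h := ((hF.indicator hS).stronglyMeasurable.integral_prod_right' (ν := volume)).measurable
    convert h using 2 with x
    rw [← integral_indicator measurableSet_Ioc]
    rfl
  exact (key ha hb).sub (key hb ha)

theorem measurable_weylDerivLeft {α a : ℝ} {f : ℝ → ℝ} (hf : Measurable f) :
    Measurable (weylDerivLeft α a f) := by
  have h : Measurable fun x => ∫ y in a..x, (f x - f y) / (x - y) ^ (α + 1) :=
    measurable_intervalIntegral_of_uncurry (by unfold Function.uncurry; fun_prop)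
      measurable_const measurable_id
  unfold weylDerivLeft
  fun_prop

theorem measurable_weylDerivRight {α b : ℝ} {g : ℝ → ℝ} (hg : Measurable g) :
    Measurable (weylDerivRight α b g) := by
  have h : Measurable fun x => ∫ y in x..b, (g x - g y) / (y - x) ^ (α + 1) :=
    measurable_intervalIntegral_of_uncurry (by unfold Function.uncurry; fun_prop)
      measurable_id measurable_const
  unfold weylDerivRight
  fun_prop

theorem enorm_div_of_pos (a : ℝ) {p : ℝ} (hp : 0 < p) : ‖a / p‖ₑ = ‖a‖ₑ / ENNReal.ofReal p := by
  rw [Real.enorm_eq_ofReal_abs, Real.enorm_eq_ofReal_abs, abs_div, abs_of_pos hp,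
    ENNReal.ofReal_div_of_pos hp]

theorem abs_intervalIntegral_le_of_lintegral {F : ℝ → ℝ} {a b A : ℝ} (hab : a ≤ b) (hA : 0 ≤ A)
    (h : ∫⁻ y in Ioo a b, ‖F y‖ₑ ≤ ENNReal.ofReal A) : |∫ y in a..b, F y| ≤ A := by
  rw [intervalIntegral.integral_of_le hab, integral_Ioc_eq_integral_Ioo, ← Real.norm_eq_abs,
    ← ENNReal.ofReal_le_ofReal_iff hA, ofReal_norm]
  exact (enorm_integral_le_lintegral_enorm _).trans h

theorem abs_weylDerivLeft_le {α T A x : ℝ} {f : ℝ → ℝ} (hα : 0 < α) (hα1 : α < 1)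
    (hA : 0 ≤ A) (hx : 0 < x) (hxT : x ≤ T) (h1 : |f x| ≤ A)
    (h2 : ∫⁻ y in Ioo 0 x, ‖f x - f y‖ₑ / ENNReal.ofReal ((x - y) ^ (α + 1)) ≤ ENNReal.ofReal A) :
    |weylDerivLeft α 0 f x| ≤ 1 / Real.Gamma (1 - α) * (A * (1 + α * T ^ α)) * x ^ (-α) := by
  have hG : 0 < Real.Gamma (1 - α) := Real.Gamma_pos_of_pos (by linarith)
  have hI : |∫ y in (0 : ℝ)..x, (f x - f y) / (x - y) ^ (α + 1)| ≤ A := by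
    refine abs_intervalIntegral_le_of_lintegral hx.le hA (le_trans (le_of_eq ?_) h2)
    refine setLIntegral_congr_fun measurableSet_Ioo fun y hy => ?_
    exact enorm_div_of_pos _ (Real.rpow_pos_of_pos (by linarith [hy.2]) _)
  have hxp : 0 < x ^ (-α) := Real.rpow_pos_of_pos hx _
  have h1' : |f x / (x - 0) ^ α| ≤ A * x ^ (-α) := by
    rw [sub_zero, abs_div, abs_of_pos (Real.rpow_pos_of_pos hx α), Real.rpow_neg hx.le,
      div_eq_mul_inv]
    gcongr
  -- Absorbs the bounded integral term into the singular one, at the price of `T ^ α`.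
  have h3 : 1 ≤ T ^ α * x ^ (-α) := by
    rw [Real.rpow_neg hx.le, ← div_eq_mul_inv, le_div_iff₀ (Real.rpow_pos_of_pos hx α), one_mul]
    exact Real.rpow_le_rpow hx.le hxT hα.le
  unfold weylDerivLeft
  rw [abs_mul, abs_of_pos (by positivity), mul_assoc]
  gcongr
  calc _ ≤ |f x / (x - 0) ^ α| + |α * ∫ y in (0 : ℝ)..x, (f x - f y) / (x - y) ^ (α + 1)| :=
        abs_add_le _ _
    _ ≤ A * x ^ (-α) + α * A := by
        rw [abs_mul, abs_of_pos hα]; gcongr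
    _ ≤ A * x ^ (-α) + α * A * (T ^ α * x ^ (-α)) := by
        gcongr _ + ?_; exact le_mul_of_one_le_right (by positivity) h3
    _ = _ := by ring

theorem intervalIntegrable_of_lintegral {G : ℝ → ℝ} {γ C x t : ℝ} (hG : Measurable G) (hxt : x ≤ t)
    (h2 : ∫⁻ y in Ioo x t, ‖G y - G x‖ₑ / ENNReal.ofReal ((y - x) ^ (γ + 1)) ≤ ENNReal.ofReal C) :
    IntervalIntegrable (fun y => (G x - G y) / (y - x) ^ (γ + 1)) volume x t := by
  rw [intervalIntegrable_iff_integrableOn_Ioo_of_le hxt]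
  refine ⟨(Measurable.aestronglyMeasurable (by fun_prop)), ?_⟩
  rw [hasFiniteIntegral_iff_enorm]
  refine lt_of_le_of_lt (le_trans (le_of_eq ?_) h2) ENNReal.ofReal_lt_top
  refine setLIntegral_congr_fun measurableSet_Ioo fun y hy => ?_
  rw [enorm_div_of_pos _ (Real.rpow_pos_of_pos (by linarith [hy.1]) _), ← enorm_neg, neg_sub]

theorem abs_integral_le_of_lintegral {G : ℝ → ℝ} {γ C x t : ℝ} (hC : 0 ≤ C) (hxt : x ≤ t)
    (h2 : ∫⁻ y in Ioo x t, ‖G y - G x‖ₑ / ENNReal.ofReal ((y - x) ^ (γ + 1)) ≤ ENNReal.ofReal C) :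
    |∫ y in x..t, (G x - G y) / (y - x) ^ (γ + 1)| ≤ C := by
  refine abs_intervalIntegral_le_of_lintegral hxt hC (le_trans (le_of_eq ?_) h2)
  refine setLIntegral_congr_fun measurableSet_Ioo fun y hy => ?_
  rw [enorm_div_of_pos _ (Real.rpow_pos_of_pos (by linarith [hy.1]) _), ← enorm_neg, neg_sub]

theorem abs_weylDerivRight_le {G : ℝ → ℝ} {γ C x t : ℝ} (hγ : 0 < γ) (hγ1 : γ < 1) (hC : 0 ≤ C)
    (hxt : x < t) (h1 : |G t - G x| ≤ C * (t - x) ^ γ)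
    (h2 : ∫⁻ y in Ioo x t, ‖G y - G x‖ₑ / ENNReal.ofReal ((y - x) ^ (γ + 1)) ≤ ENNReal.ofReal C) :
    |weylDerivRight γ t (fun u => G u - G t) x| ≤ 1 / Real.Gamma (1 - γ) * (C + γ * C) := by
  have hG : 0 < Real.Gamma (1 - γ) := Real.Gamma_pos_of_pos (by linarith)
  have hI := abs_integral_le_of_lintegral hC hxt.le h2
  have hp : 0 < (t - x) ^ γ := Real.rpow_pos_of_pos (by linarith) _
  unfold weylDerivRight
  rw [abs_mul, abs_of_pos (by positivity)]
  gcongr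
  refine (abs_add_le _ _).trans ?_
  gcongr
  · rw [abs_div, abs_of_pos hp, div_le_iff₀ hp, abs_sub_comm]; exact h1
  · rw [abs_mul, abs_of_pos hγ]
    gcongr
    simpa using hI

theorem integral_sub_rpow {γ x s t : ℝ} (hγ : 0 < γ) (hxs : x < s) (hst : s ≤ t) :
    γ * ∫ y in s..t, (y - x) ^ (-(γ + 1)) = (s - x) ^ (-γ) - (t - x) ^ (-γ) := by
  rw [intervalIntegral.integral_comp_sub_right (fun y => y ^ (-(γ + 1))) x, integral_rpow]
  · rw [show -(γ + 1) + 1 = -γ by ring]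
    field_simp
    ring
  · right
    refine ⟨by linarith, ?_⟩
    rw [uIcc_of_le (by linarith)]
    intro h; linarith [h.1]

theorem integral_sub_right_rpow_neg {α s t : ℝ} (hα1 : α < 1) :
    ∫ y in s..t, (y - s) ^ (-α) = (t - s) ^ (1 - α) / (1 - α) := by
  rw [intervalIntegral.integral_comp_sub_right (fun y => y ^ (-α)) s, integral_rpow]
  · rw [sub_self, show -α + 1 = 1 - α by ring, Real.zero_rpow (by linarith), sub_zero]
  · left; linarith

theorem intervalIntegrable_sub_rpow {p a b c : ℝ} (hp : -1 < p) :
    IntervalIntegrable (fun y => (y - c) ^ p) volume a b := by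
  simpa using (intervalIntegral.intervalIntegrable_rpow' (a := a - c) (b := b - c) hp).comp_sub_right c

/-- Split `G x - G y = (G x - G s) + (G s - G y)` on `[s,t]`. The kernel integrates to `(s - x)^(-γ)
- (t - x)^(-γ)`, so every multiple of `G x - G s` cancels and only increments of `G` within `[s,t]`
remain. This is what makes the difference small with `t - s`. -/
theorem weylDerivRight_sub {G : ℝ → ℝ} {γ C x s t : ℝ} (hG : Measurable G) (hγ : 0 < γ)
    (hxs : x < s) (hst : s ≤ t)
    (h2 : ∫⁻ y in Ioo x t, ‖G y - G x‖ₑ / ENNReal.ofReal ((y - x) ^ (γ + 1)) ≤ ENNReal.ofReal C) :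
    weylDerivRight γ t (fun u => G u - G t) x - weylDerivRight γ s (fun u => G u - G s) x =
      1 / Real.Gamma (1 - γ) * ((G s - G t) * (t - x) ^ (-γ) +
        γ * ∫ y in s..t, (G s - G y) * (y - x) ^ (-(γ + 1))) := by
  have hI := intervalIntegrable_of_lintegral hG (hxs.le.trans hst) h2
  have hsub : IntervalIntegrable (fun y => (G x - G y) / (y - x) ^ (γ + 1)) volume s t :=
    hI.mono_set (by rw [uIcc_of_le hst, uIcc_of_le (hxs.le.trans hst)]; exact Icc_subset_Icc_left hxs.le)
  have hadd := intervalIntegral.integral_add_adjacent_intervals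
    (hI.mono_set (by rw [uIcc_of_le hxs.le, uIcc_of_le (hxs.le.trans hst)]
                     exact Icc_subset_Icc_right hst)) hsub
  have hrw : ∀ y ∈ uIcc s t, (G x - G y) / (y - x) ^ (γ + 1) = (G x - G y) * (y - x) ^ (-(γ + 1)) := by
    intro y hy
    rw [uIcc_of_le hst] at hy
    rw [Real.rpow_neg (by linarith [hy.1]), div_eq_mul_inv]
  have hpow : IntervalIntegrable (fun y => (y - x) ^ (-(γ + 1))) volume s t := by
    apply ContinuousOn.intervalIntegrable
    intro y hy
    rw [uIcc_of_le hst] at hy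
    exact (ContinuousAt.rpow_const (by fun_prop) (Or.inl (by linarith [hy.1]))).continuousWithinAt
  have hconst : ∫ y in s..t, (G x - G y) / (y - x) ^ (γ + 1) =
      (G x - G s) * (∫ y in s..t, (y - x) ^ (-(γ + 1))) +
        ∫ y in s..t, (G s - G y) * (y - x) ^ (-(γ + 1)) := by
    have h3 : IntervalIntegrable (fun y => (G s - G y) * (y - x) ^ (-(γ + 1))) volume s t := by
      refine (hsub.sub (hpow.const_mul (G x - G s))).congr_uIoo ?_
      intro y hy
      have := hrw y (Ioo_subset_Icc_self hy)
      simp only [this]; ring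
    rw [← intervalIntegral.integral_const_mul, ← intervalIntegral.integral_add (hpow.const_mul _) h3]
    refine intervalIntegral.integral_congr fun y hy => ?_
    rw [hrw y hy]; ring
  have hk := integral_sub_rpow hγ hxs hst
  unfold weylDerivRight
  simp only [sub_sub_sub_cancel_right]
  rw [← hadd, hconst, ← mul_sub, div_eq_mul_inv (G x - G t), div_eq_mul_inv (G x - G s),
    ← Real.rpow_neg (by linarith), ← Real.rpow_neg (by linarith)]
  congr 1
  linear_combination (G x - G s) * hk

theorem abs_weylDerivRight_sub_le {G : ℝ → ℝ} {γ C x s t : ℝ} (hG : Measurable G) (hγ : 0 < γ)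
    (hγ1 : γ < 1) (hC : 0 ≤ C) (hxs : x < s) (hst : s < t)
    (h1 : ∀ y, s < y → y ≤ t → |G y - G s| ≤ C * (y - s) ^ γ)
    (h2 : ∫⁻ y in Ioo x t, ‖G y - G x‖ₑ / ENNReal.ofReal ((y - x) ^ (γ + 1)) ≤ ENNReal.ofReal C) :
    |weylDerivRight γ t (fun u => G u - G t) x - weylDerivRight γ s (fun u => G u - G s) x| ≤
      1 / Real.Gamma (1 - γ) * (C + γ * (C / γ)) * (t - s) ^ γ * (s - x) ^ (-γ) := by
  have hΓ : 0 < Real.Gamma (1 - γ) := Real.Gamma_pos_of_pos (by linarith)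
  rw [weylDerivRight_sub hG hγ hxs hst.le h2, abs_mul, abs_of_pos (by positivity), mul_assoc, mul_assoc]
  gcongr
  have hsx : 0 < (s - x) ^ (-γ) := Real.rpow_pos_of_pos (by linarith) _
  have hI : |∫ y in s..t, (G s - G y) * (y - x) ^ (-(γ + 1))| ≤ C / γ * (t - s) ^ γ * (s - x) ^ (-γ) := by
    rw [← Real.norm_eq_abs]
    have hint : IntervalIntegrable (fun y => C * (s - x) ^ (-γ) * (y - s) ^ (-(1 - γ))) volume s t :=
      (intervalIntegrable_sub_rpow (by linarith)).const_mul _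
    refine (intervalIntegral.norm_integral_le_of_norm_le hst.le (ae_of_all _ fun y hy => ?_) hint).trans ?_
    · have hys : 0 < y - s := by linarith [hy.1]
      have hyx : 0 < y - x := by linarith
      -- Part of the kernel is spent on the singularity at `x = s`. The remaining `(y - s)^(-1)`,
      -- times the Hölder bound `(y - s)^γ`, is integrable with integral `(t - s)^γ / γ`.
      have e1 : (y - x) ^ (-(γ + 1)) ≤ (s - x) ^ (-γ) * (y - s) ^ (-1 : ℝ) := by
        rw [show -(γ + 1) = -γ + -1 by ring, Real.rpow_add hyx]
        gcongr ?_ * ?_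
        · exact Real.rpow_le_rpow_of_nonpos (by linarith) (by linarith) (by linarith)
        · exact Real.rpow_le_rpow_of_nonpos (by linarith) (by linarith) (by norm_num)
      rw [norm_mul, Real.norm_eq_abs, Real.norm_eq_abs, abs_sub_comm,
        abs_of_pos (Real.rpow_pos_of_pos hyx _)]
      calc _ ≤ (C * (y - s) ^ γ) * ((s - x) ^ (-γ) * (y - s) ^ (-1 : ℝ)) := by
            gcongr; exact h1 y hy.1 hy.2
        _ = C * (s - x) ^ (-γ) * ((y - s) ^ γ * (y - s) ^ (-1 : ℝ)) := by ring
        _ = _ := by rw [← Real.rpow_add hys]; congr 2; ring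
    · rw [intervalIntegral.integral_const_mul, integral_sub_right_rpow_neg (by linarith)]
      rw [show 1 - (1 - γ) = γ by ring]
      apply le_of_eq; ring
  have hT : |(G s - G t) * (t - x) ^ (-γ)| ≤ C * (t - s) ^ γ * (s - x) ^ (-γ) := by
    rw [abs_mul, abs_sub_comm, abs_of_pos (Real.rpow_pos_of_pos (by linarith) _)]
    gcongr ?_ * ?_
    · exact Real.rpow_nonneg (by linarith) _
    · exact h1 t hst le_rfl
    · exact Real.rpow_le_rpow_of_nonpos (by linarith) (by linarith) (by linarith)
  calc _ ≤ _ := abs_add_le _ _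
    _ ≤ C * (t - s) ^ γ * (s - x) ^ (-γ) + γ * (C / γ * (t - s) ^ γ * (s - x) ^ (-γ)) := by
      rw [abs_mul γ, abs_of_pos hγ]; gcongr
    _ = _ := by ring
-- Hölder dependence of the fractional integral on its upper endpoint.
-- On each half of `(0,s)` only one factor is singular; the other is bounded by its value at `s /
-- 2`. This replaces the Beta integral by elementary ones.
theorem rpow_mul_rpow_le {α s x : ℝ} (hα : 0 < α) (hα1 : α < 1) (hx : 0 < x) (hxs : x < s) :
    x ^ (-α) * (s - x) ^ (-(1 - α)) ≤
      (s / 2) ^ (-(1 - α)) * x ^ (-α) + (s / 2) ^ (-α) * (s - x) ^ (-(1 - α)) := by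
  have h1 : 0 < x ^ (-α) := Real.rpow_pos_of_pos hx _
  have h2 : 0 < (s - x) ^ (-(1 - α)) := Real.rpow_pos_of_pos (by linarith) _
  have h3 : 0 < (s / 2) ^ (-α) := Real.rpow_pos_of_pos (by linarith) _
  have h4 : 0 < (s / 2) ^ (-(1 - α)) := Real.rpow_pos_of_pos (by linarith) _
  rcases le_total x (s / 2) with h | h
  · have : (s - x) ^ (-(1 - α)) ≤ (s / 2) ^ (-(1 - α)) :=
      Real.rpow_le_rpow_of_nonpos (by linarith) (by linarith) (by linarith)
    have := mul_le_mul_of_nonneg_left this h1.le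
    have := mul_pos h3 h2
    linarith
  · have : x ^ (-α) ≤ (s / 2) ^ (-α) :=
      Real.rpow_le_rpow_of_nonpos (by linarith) (by linarith) (by linarith)
    have := mul_le_mul_of_nonneg_right this h2.le
    have := mul_pos h4 h1
    linarith

/-- The exponents sum to `-1`, so the integral is scale invariant and the bound is uniform in `s`.
-/
theorem integral_rpow_dominating {α s : ℝ} (hα : 0 < α) (hα1 : α < 1) (hs : 0 < s) :
    ∫ x in (0 : ℝ)..s, ((s / 2) ^ (-(1 - α)) * x ^ (-α) + (s / 2) ^ (-α) * (s - x) ^ (-(1 - α))) =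
      2 ^ (1 - α) / (1 - α) + 2 ^ α / α := by
  have i1 : IntervalIntegrable (fun x : ℝ => x ^ (-α)) volume 0 s :=
    intervalIntegral.intervalIntegrable_rpow' (by linarith)
  have i2 : IntervalIntegrable (fun x : ℝ => (s - x) ^ (-(1 - α))) volume 0 s := by
    simpa using ((intervalIntegral.intervalIntegrable_rpow' (a := 0) (b := s) (r := -(1 - α))
      (by linarith)).comp_sub_left s).symm
  have e1 : ∫ x in (0 : ℝ)..s, x ^ (-α) = s ^ (1 - α) / (1 - α) := by
    simpa using integral_sub_right_rpow_neg (s := 0) (t := s) hα1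
  have e2 : ∫ x in (0 : ℝ)..s, (s - x) ^ (-(1 - α)) = s ^ α / α := by
    rw [intervalIntegral.integral_comp_sub_left (fun x => x ^ (-(1 - α)))]
    simpa using integral_sub_right_rpow_neg (α := 1 - α) (s := 0) (t := s) (by linarith)
  rw [intervalIntegral.integral_add (i1.const_mul _) (i2.const_mul _),
    intervalIntegral.integral_const_mul, intervalIntegral.integral_const_mul, e1, e2]
  have h : ∀ p : ℝ, (s / 2) ^ (-p) * s ^ p = 2 ^ p := by
    intro p
    rw [Real.rpow_neg (by positivity), Real.div_rpow hs.le (by norm_num)]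
    have := (Real.rpow_pos_of_pos hs p).ne'
    field_simp
  rw [← mul_div_assoc, ← mul_div_assoc, h, h]

/-- The integrals `∫_0^t φ ψ_t` depend on `t` in a `(1-α)`-Hölder way if `φ` has a singularity of
order `α` at `0` and `ψ_t - ψ_s` one of order `1-α` at `s`. -/
theorem abs_integral_mul_sub_le {α T K K₂ K₃ : ℝ} {φ : ℝ → ℝ} {ψ : ℝ → ℝ → ℝ}
    (hα : 0 < α) (hα1 : α < 1) (hK : 0 ≤ K) (hK₂ : 0 ≤ K₂) (hK₃ : 0 ≤ K₃)
    (hφ : Measurable φ) (hψ : ∀ t, Measurable (ψ t))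
    (hφb : ∀ x, 0 < x → x ≤ T → |φ x| ≤ K * x ^ (-α))
    (hψb : ∀ x t, 0 < x → x < t → t ≤ T → |ψ t x| ≤ K₂)
    (hψd : ∀ x s t, 0 < x → x < s → s < t → t ≤ T →
      |ψ t x - ψ s x| ≤ K₃ * (t - s) ^ (1 - α) * (s - x) ^ (-(1 - α)))
    {s t : ℝ} (hs : 0 ≤ s) (hst : s ≤ t) (htT : t ≤ T) :
    |(∫ x in (0 : ℝ)..t, φ x * ψ t x) - ∫ x in (0 : ℝ)..s, φ x * ψ s x| ≤
      (K * K₂ / (1 - α) + K * K₃ * (2 ^ (1 - α) / (1 - α) + 2 ^ α / α)) * (t - s) ^ (1 - α) := by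
  have hint : ∀ t, 0 ≤ t → t ≤ T → IntervalIntegrable (fun x => φ x * ψ t x) volume 0 t := by
    intro t ht htT
    rw [intervalIntegrable_iff_integrableOn_Ioo_of_le ht]
    have hi : IntegrableOn (fun x : ℝ => K * x ^ (-α) * K₂) (Ioo 0 t) := by
      rw [← intervalIntegrable_iff_integrableOn_Ioo_of_le ht]
      exact ((intervalIntegral.intervalIntegrable_rpow' (by linarith)).const_mul K).mul_const K₂
    refine Integrable.mono' hi (hφ.mul (hψ t)).aestronglyMeasurable ?_
    refine (ae_restrict_mem measurableSet_Ioo).mono fun x hx => ?_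
    rw [Real.norm_eq_abs, abs_mul]
    gcongr
    · exact (abs_nonneg _).trans (hφb x hx.1 (hx.2.le.trans htT))
    · exact hφb x hx.1 (hx.2.le.trans htT)
    · exact hψb x t hx.1 hx.2 htT
  have it := hint t (hs.trans hst) htT
  have is := hint s hs (hst.trans htT)
  have it1 : IntervalIntegrable (fun x => φ x * ψ t x) volume 0 s :=
    it.mono_set (by rw [uIcc_of_le hs, uIcc_of_le (hs.trans hst)]; exact Icc_subset_Icc_right hst)
  have it2 : IntervalIntegrable (fun x => φ x * ψ t x) volume s t :=
    it.mono_set (by rw [uIcc_of_le hst, uIcc_of_le (hs.trans hst)]; exact Icc_subset_Icc_left hs)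
  rw [← intervalIntegral.integral_add_adjacent_intervals it1 it2, add_sub_right_comm,
    ← intervalIntegral.integral_sub it1 is]
  rcases hst.eq_or_lt with rfl | hst'
  · simp [Real.zero_rpow (show (1 - α) ≠ 0 by linarith)]
  have hp : 0 ≤ (t - s) ^ (1 - α) := Real.rpow_nonneg (by linarith) _
  -- The bounds on `ψ` need `x` strictly below the endpoint, so the endpoints are discarded as null
  -- sets.
  have hneT : ∀ᵐ x ∂(volume : Measure ℝ), x ≠ t := by simp [ae_iff]
  have hneS : ∀ᵐ x ∂(volume : Measure ℝ), x ≠ s := by simp [ae_iff]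
  have b2 : |∫ x in s..t, φ x * ψ t x| ≤ K * K₂ / (1 - α) * (t - s) ^ (1 - α) := by
    rw [← Real.norm_eq_abs]
    have hi : IntervalIntegrable (fun x : ℝ => K * K₂ * (x - s) ^ (-α)) volume s t :=
      (intervalIntegrable_sub_rpow (by linarith)).const_mul _
    refine (intervalIntegral.norm_integral_le_of_norm_le hst ?_ hi).trans ?_
    · filter_upwards [hneT] with x hxt hx
      have hx0 : 0 < x := hs.trans_lt hx.1
      rw [Real.norm_eq_abs, abs_mul]
      calc |φ x| * |ψ t x| ≤ (K * x ^ (-α)) * K₂ := by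
            gcongr
            · exact hφb x hx0 (hx.2.trans htT)
            · exact hψb x t hx0 (lt_of_le_of_ne hx.2 hxt) htT
        -- Moving the singularity from `0` to `s` gives a bound depending on `t - s` alone.
        _ ≤ (K * (x - s) ^ (-α)) * K₂ := by
            gcongr K * ?_ * K₂
            exact Real.rpow_le_rpow_of_nonpos (by linarith [hx.1]) (by linarith) (by linarith)
        _ = _ := by ring
    · rw [intervalIntegral.integral_const_mul, integral_sub_right_rpow_neg hα1]
      apply le_of_eq; ring
  have b1 : |∫ x in (0 : ℝ)..s, (φ x * ψ t x - φ x * ψ s x)| ≤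
      K * K₃ * (2 ^ (1 - α) / (1 - α) + 2 ^ α / α) * (t - s) ^ (1 - α) := by
    rcases hs.eq_or_lt with rfl | hs'
    · rw [intervalIntegral.integral_same, abs_zero]
      have : 0 < 1 - α := by linarith
      positivity
    rw [← Real.norm_eq_abs]
    have i1 : IntervalIntegrable (fun x : ℝ => x ^ (-α)) volume 0 s :=
      intervalIntegral.intervalIntegrable_rpow' (by linarith)
    have i2 : IntervalIntegrable (fun x : ℝ => (s - x) ^ (-(1 - α))) volume 0 s := by
      simpa using ((intervalIntegral.intervalIntegrable_rpow' (a := 0) (b := s) (r := -(1 - α))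
        (by linarith)).comp_sub_left s).symm
    refine (intervalIntegral.norm_integral_le_of_norm_le hs ?_
      (((i1.const_mul ((s / 2) ^ (-(1 - α)))).add (i2.const_mul ((s / 2) ^ (-α)))).const_mul
        (K * K₃ * (t - s) ^ (1 - α)))).trans ?_
    · filter_upwards [hneS] with x hxs hx
      have hxs' := lt_of_le_of_ne hx.2 hxs
      rw [Real.norm_eq_abs, ← mul_sub, abs_mul]
      calc |φ x| * |ψ t x - ψ s x| ≤
            (K * x ^ (-α)) * (K₃ * (t - s) ^ (1 - α) * (s - x) ^ (-(1 - α))) := by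
            gcongr
            · exact (abs_nonneg _).trans (hφb x hx.1 (hx.2.trans (hst.trans htT)))
            · exact hφb x hx.1 (hx.2.trans (hst.trans htT))
            · exact hψd x s t hx.1 hxs' hst' htT
        _ = K * K₃ * (t - s) ^ (1 - α) * (x ^ (-α) * (s - x) ^ (-(1 - α))) := by ring
        _ ≤ _ := mul_le_mul_of_nonneg_left (rpow_mul_rpow_le hα hα1 hx.1 hxs') (by positivity)
    · rw [intervalIntegral.integral_const_mul, integral_rpow_dominating hα hα1 hs']
      apply le_of_eq; ring
  calc _ ≤ _ := abs_add_le _ _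
    _ ≤ _ := add_le_add b1 b2
    _ = _ := by ring

/-- The left derivative of `f` is singular only like `x^(-α)`, the right derivative of `G` is
bounded, and moving its endpoint from `s` to `t` costs `(t - s)^(1-α) (s - x)^(-(1-α))`. -/
theorem exists_holder_integral_weylDeriv {α T A C : ℝ} {f G : ℝ → ℝ} (hα : 0 < α) (hα1 : α < 1)
    (hT : 0 < T) (hA : 0 ≤ A) (hC : 0 ≤ C) (hf : Measurable f) (hG : Measurable G)
    (hf1 : ∀ x, 0 < x → x ≤ T → |f x| ≤ A)
    (hf2 : ∀ x, 0 < x → x ≤ T →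
      ∫⁻ y in Ioo 0 x, ‖f x - f y‖ₑ / ENNReal.ofReal ((x - y) ^ (α + 1)) ≤ ENNReal.ofReal A)
    (hG1 : ∀ s t, 0 < s → s < t → t ≤ T → |G t - G s| ≤ C * (t - s) ^ (1 - α))
    (hG2 : ∀ s t, 0 < s → s < t → t ≤ T →
      ∫⁻ y in Ioo s t, ‖G y - G s‖ₑ / ENNReal.ofReal ((y - s) ^ (1 - α + 1)) ≤ ENNReal.ofReal C) :
    ∃ D, 0 ≤ D ∧ ∀ s t, 0 ≤ s → s ≤ t → t ≤ T →
      |(∫ x in (0 : ℝ)..t, weylDerivLeft α 0 f x * weylDerivRight (1 - α) t (fun u => G u - G t) x) -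
        ∫ x in (0 : ℝ)..s, weylDerivLeft α 0 f x * weylDerivRight (1 - α) s (fun u => G u - G s) x| ≤
        D * (t - s) ^ (1 - α) := by
  have h1α : 0 < 1 - α := by linarith
  have hΓ1 : 0 < Real.Gamma (1 - α) := Real.Gamma_pos_of_pos h1α
  have hΓ2 : 0 < Real.Gamma (1 - (1 - α)) := Real.Gamma_pos_of_pos (by linarith)
  refine ⟨_, ?_, fun s t hs hst htT => abs_integral_mul_sub_le hα hα1
    (K := 1 / Real.Gamma (1 - α) * (A * (1 + α * T ^ α)))
    (K₂ := 1 / Real.Gamma (1 - (1 - α)) * (C + (1 - α) * C))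
    (K₃ := 1 / Real.Gamma (1 - (1 - α)) * (C + (1 - α) * (C / (1 - α))))
    (ψ := fun t => weylDerivRight (1 - α) t (fun u => G u - G t))
    (by positivity) (by positivity) (by positivity) (measurable_weylDerivLeft hf)
    (fun t => measurable_weylDerivRight (by fun_prop))
    (fun x hx hxT => abs_weylDerivLeft_le hα hα1 hA hx hxT (hf1 x hx hxT) (hf2 x hx hxT))
    (fun x t hx hxt htT => abs_weylDerivRight_le h1α (by linarith) hC hxt (hG1 x t hx hxt htT)
      (hG2 x t hx hxt htT))
    (fun x s t hx hxs hst htT => abs_weylDerivRight_sub_le hG h1α (by linarith) hC hxs hst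
      (fun y hsy hyt => hG1 s y (hx.trans hxs) hsy (hyt.trans htT))
      (hG2 x t hx (hxs.trans hst) htT)) hs hst htT⟩
  positivity

/-! ### Left limits of the integrator and the generalized Stieltjes integral. -/

/-- The Hölder bound makes `g` uniformly continuous on the open interval, so it maps `𝓝[<] t` to a
Cauchy filter, even at `t = T`. Without an existing limit, `Function.leftLim` would only be a
default value. -/
theorem tendsto_leftLim_of_holder {γ T C : ℝ} {g : ℝ → ℝ} (hγ : 0 < γ)
    (h1 : ∀ s t, 0 < s → s < t → t < T → |g t - g s| ≤ C * (t - s) ^ γ) {t : ℝ} (ht : t ∈ Ioc 0 T) :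
    Tendsto g (𝓝[<] t) (𝓝 (Function.leftLim g t)) := by
  have hU : UniformContinuousOn g (Ioo 0 T) := by
    rw [Metric.uniformContinuousOn_iff]
    intro ε hε
    have hlim : Tendsto (fun δ : ℝ => C * δ ^ γ) (𝓝 0) (𝓝 (C * 0 ^ γ)) :=
      ((Real.continuous_rpow_const hγ.le).tendsto 0).const_mul C
    rw [Real.zero_rpow hγ.ne', mul_zero] at hlim
    obtain ⟨δ, hδ, hδ'⟩ := Metric.eventually_nhds_iff.1 (hlim.eventually (gt_mem_nhds hε))
    refine ⟨δ, hδ, ?_⟩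
    have key : ∀ s ∈ Ioo 0 T, ∀ t ∈ Ioo 0 T, s < t → dist s t < δ → dist (g s) (g t) < ε := by
      intro s hs t ht hst hd
      rw [dist_comm, Real.dist_eq]
      refine (h1 s t hs.1 hst ht.2).trans_lt (hδ' ?_)
      rwa [Real.dist_0_eq_abs, ← Real.dist_eq, dist_comm]
    intro s hs t ht hd
    rcases lt_trichotomy s t with h | h | h
    · exact key s hs t ht h hd
    · simp [h, hε]
    · rw [dist_comm] at hd ⊢
      exact key t ht s hs h hd
  have hc : Cauchy (map g (𝓝[<] t)) := by
    refine (cauchy_nhds.mono nhdsWithin_le_nhds).map_of_le hU ?_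
    rw [le_principal_iff]
    exact mem_of_superset (Ioo_mem_nhdsLT ht.1) (Ioo_subset_Ioo_right ht.2)
  exact tendsto_leftLim_of_tendsto (cauchy_map_iff_exists_tendsto.1 hc)

theorem lintegral_Ioo_le_of_forall_lt {F : ℝ → ℝ≥0∞} {s T : ℝ} {c : ℝ≥0∞} (hs : s < T)
    (h : ∀ t, s < t → t < T → ∫⁻ y in Ioo s t, F y ≤ c) : ∫⁻ y in Ioo s T, F y ≤ c := by
  obtain ⟨u, hu, hmem, hlim⟩ := exists_seq_strictMono_tendsto' hs
  have hU : Ioo s T = ⋃ n, Ioo s (u n) := by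
    ext x
    simp only [mem_Ioo, mem_iUnion]
    refine ⟨fun hx => ?_, fun ⟨n, hn⟩ => ⟨hn.1, hn.2.trans (hmem n).2⟩⟩
    obtain ⟨n, hn⟩ := (hlim.eventually (lt_mem_nhds hx.2)).exists
    exact ⟨n, hx.1, hn⟩
  rw [hU, setLIntegral_iUnion_of_directed]
  · exact iSup_le fun n => h _ (hmem n).1 (hmem n).2
  · exact Monotone.directed_le fun a b hab => Ioo_subset_Ioo_right (hu.monotone hab)

/-- The norm of `g` sees only `(0,T)`, while the integral up to `T` uses `g(T-)`. Taking `G` to be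
the left limit on `(0,T]` and `0` elsewhere keeps `g` inside and turns `g(t-)` into `G t`. The
bounds reach `T` by passing to the limit and by monotone convergence. -/
theorem exists_leftLim_extension {γ T C : ℝ} {g : ℝ → ℝ} (hγ : 0 < γ)
    (h1 : ∀ s t, 0 < s → s < t → t < T → |g t - g s| ≤ C * (t - s) ^ γ)
    (h2 : ∀ s t, 0 < s → s < t → t < T →
      ∫⁻ y in Ioo s t, ‖g y - g s‖ₑ / ENNReal.ofReal ((y - s) ^ (γ + 1)) ≤ ENNReal.ofReal C) :
    ∃ G : ℝ → ℝ, Measurable G ∧ (∀ t ∈ Ioo 0 T, G t = g t) ∧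
      (∀ t ∈ Ioc 0 T, G t = Function.leftLim g t) ∧
      (∀ s t, 0 < s → s < t → t ≤ T → |G t - G s| ≤ C * (t - s) ^ γ) ∧
      (∀ s t, 0 < s → s < t → t ≤ T →
        ∫⁻ y in Ioo s t, ‖G y - G s‖ₑ / ENNReal.ofReal ((y - s) ^ (γ + 1)) ≤ ENNReal.ofReal C) := by
  classical
  have hcont : Continuous fun u : ℝ => C * u ^ γ :=
    continuous_const.mul (Real.continuous_rpow_const hγ.le)
  have hl := fun t ht => tendsto_leftLim_of_holder (t := t) hγ h1 ht
  have hlt : ∀ s t, 0 < s → s < t → t ≤ T → |Function.leftLim g t - g s| ≤ C * (t - s) ^ γ := by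
    intro s t hs hst ht
    have e1 : Tendsto (fun u => |g u - g s|) (𝓝[<] t) (𝓝 |Function.leftLim g t - g s|) :=
      ((hl t ⟨hs.trans hst, ht⟩).sub_const _).abs
    have e2 : Tendsto (fun u => C * (u - s) ^ γ) (𝓝[<] t) (𝓝 (C * (t - s) ^ γ)) :=
      ((hcont.comp (by fun_prop : Continuous fun u => (u - s))).tendsto t).mono_left nhdsWithin_le_nhds
    refine le_of_tendsto_of_tendsto e1 e2 ?_
    filter_upwards [Ioo_mem_nhdsLT hst] with u hu
    exact h1 s u hs hu.1 (hu.2.trans_le ht)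
  have heq : ∀ t ∈ Ioo 0 T, Function.leftLim g t = g t := by
    intro t ht
    have e1 : Tendsto (fun u => |g t - g u|) (𝓝[<] t) (𝓝 |g t - Function.leftLim g t|) :=
      ((hl t ⟨ht.1, ht.2.le⟩).const_sub _).abs
    have e2 : Tendsto (fun u => C * (t - u) ^ γ) (𝓝[<] t) (𝓝 (C * (t - t) ^ γ)) :=
      ((hcont.comp (by fun_prop : Continuous fun u => (t - u))).tendsto t).mono_left nhdsWithin_le_nhds
    rw [sub_self, Real.zero_rpow hγ.ne', mul_zero] at e2
    have : |g t - Function.leftLim g t| ≤ 0 := by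
      refine le_of_tendsto_of_tendsto e1 e2 ?_
      filter_upwards [Ioo_mem_nhdsLT ht.1] with u hu
      exact h1 u t hu.1 hu.2 ht.2
    have := abs_nonpos_iff.1 this
    linarith
  have hGI : ∀ t ∈ Ioo 0 T, (Ioc 0 T).piecewise (Function.leftLim g) 0 t = g t := fun t ht => by
    rw [piecewise_eq_of_mem _ _ _ (Ioo_subset_Ioc_self ht), heq t ht]
  have hGC : ∀ t ∈ Ioc 0 T, (Ioc 0 T).piecewise (Function.leftLim g) 0 t = Function.leftLim g t :=
    fun t ht => piecewise_eq_of_mem _ _ _ ht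
  have hH : ∀ s t, 0 < s → s < t → t ≤ T → |(Ioc 0 T).piecewise (Function.leftLim g) 0 t -
      (Ioc 0 T).piecewise (Function.leftLim g) 0 s| ≤ C * (t - s) ^ γ := by
    intro s t hs hst ht
    rw [hGC t ⟨hs.trans hst, ht⟩, hGI s ⟨hs, hst.trans_le ht⟩]
    exact hlt s t hs hst ht
  have hI : ∀ s t, 0 < s → s < t → t ≤ T → ∫⁻ y in Ioo s t,
      ‖(Ioc 0 T).piecewise (Function.leftLim g) 0 y - (Ioc 0 T).piecewise (Function.leftLim g) 0 s‖ₑ /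
        ENNReal.ofReal ((y - s) ^ (γ + 1)) ≤ ENNReal.ofReal C := by
    intro s t hs hst ht
    refine lintegral_Ioo_le_of_forall_lt hst fun u hsu hut => ?_
    refine (le_of_eq ?_).trans (h2 s u hs hsu (hut.trans_le ht))
    refine setLIntegral_congr_fun measurableSet_Ioo fun y hy => ?_
    rw [hGI y ⟨hs.trans hy.1, (hy.2.trans hut).trans_le ht⟩, hGI s ⟨hs, hst.trans_le ht⟩]
  refine ⟨(Ioc 0 T).piecewise (Function.leftLim g) 0, ?_, hGI, hGC, hH, hI⟩
  refine ContinuousOn.measurable_piecewise ?_ continuousOn_const measurableSet_Ioc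
  refine ContinuousOn.congr (f := (Ioc 0 T).piecewise (Function.leftLim g) 0) ?_
    (fun t ht => (hGC t ht).symm)
  intro t ht
  have hb : ∀ u ∈ Ioc 0 T, dist ((Ioc 0 T).piecewise (Function.leftLim g) 0 u)
      ((Ioc 0 T).piecewise (Function.leftLim g) 0 t) ≤ C * |u - t| ^ γ := by
    intro u hu
    rw [Real.dist_eq]
    rcases lt_trichotomy u t with h | h | h
    · rw [abs_sub_comm, abs_sub_comm u, abs_of_pos (by linarith : 0 < t - u)]
      exact hH u t hu.1 h ht.2
    · simp [h, Real.zero_rpow hγ.ne']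
    · rw [abs_of_pos (by linarith : 0 < u - t)]
      exact hH t u ht.1 h hu.2
  refine tendsto_iff_dist_tendsto_zero.2 ?_
  have e2 : Tendsto (fun u => C * |u - t| ^ γ) (𝓝[Ioc 0 T] t) (𝓝 (C * |t - t| ^ γ)) :=
    ((hcont.comp (by fun_prop : Continuous fun u => |u - t|)).tendsto t).mono_left nhdsWithin_le_nhds
  rw [sub_self, abs_zero, Real.zero_rpow hγ.ne', mul_zero] at e2
  exact squeeze_zero' (Eventually.of_forall fun _ => dist_nonneg)
    (eventually_mem_nhdsWithin.mono hb) e2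

theorem weylDerivLeft_congr {α a x : ℝ} {f f' : ℝ → ℝ} (hx : a < x)
    (hf : ∀ y ∈ Ioc a x, f y = f' y) : weylDerivLeft α a f x = weylDerivLeft α a f' x := by
  unfold weylDerivLeft
  rw [hf x ⟨hx, le_rfl⟩]
  congr 3
  refine intervalIntegral.integral_congr_Ioo_of_le hx.le fun y hy => ?_
  rw [hf y ⟨hy.1, hy.2.le⟩]

theorem weylDerivRight_congr {α b x : ℝ} {g g' : ℝ → ℝ} (hx : x < b)
    (hg : ∀ y ∈ Ico x b, g y = g' y) : weylDerivRight α b g x = weylDerivRight α b g' x := by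
  unfold weylDerivRight
  rw [hg x ⟨le_rfl, hx⟩]
  congr 3
  refine intervalIntegral.integral_congr_Ioo_of_le hx.le fun y hy => ?_
  rw [hg y ⟨hy.1.le, hy.2⟩]

theorem fracStieltjes_congr_left {α t : ℝ} {f f' g : ℝ → ℝ} (ht : 0 ≤ t)
    (hf : ∀ x ∈ Ioo 0 t, f x = f' x) : fracStieltjes α 0 t f g = fracStieltjes α 0 t f' g := by
  unfold fracStieltjes
  congr 1
  refine intervalIntegral.integral_congr_Ioo_of_le ht fun x hx => ?_
  rw [weylDerivLeft_congr hx.1 fun y hy => hf y ⟨hy.1, hy.2.trans_lt hx.2⟩]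

/-- Only the values of the integrand and of the integrator on the open interval matter. -/
theorem fracStieltjes_eq_of_eqOn {α t : ℝ} {f f' g G : ℝ → ℝ} (ht : 0 ≤ t)
    (hf : ∀ x ∈ Ioo 0 t, f x = f' x) (hg : ∀ x ∈ Ioo 0 t, g x = G x)
    (hG : Function.leftLim g t = G t) :
    fracStieltjes α 0 t f g = -∫ x in (0 : ℝ)..t,
      weylDerivLeft α 0 f' x * weylDerivRight (1 - α) t (fun u => G u - G t) x := by
  rw [fracStieltjes_congr_left ht hf]
  unfold fracStieltjes
  congr 1
  refine intervalIntegral.integral_congr_Ioo_of_le ht fun x hx => ?_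
  rw [hG, weylDerivRight_congr hx.2 fun y hy => ?_]
  rw [hg y ⟨hx.1.trans_le hy.1, hy.2⟩]

/-- Replaces `f` by its extension by zero, which is globally measurable, and `g` by its left-limit
extension; neither change affects the integral. -/
theorem exists_holder_fracStieltjes {α T A C : ℝ} {f g : ℝ → ℝ} (hα : 0 < α) (hα1 : α < 1)
    (hT : 0 < T) (hA : 0 ≤ A) (hC : 0 ≤ C) (hf : ContinuousOn f (Icc 0 T))
    (hf1 : ∀ x, 0 < x → x ≤ T → |f x| ≤ A)
    (hf2 : ∀ x, 0 < x → x ≤ T →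
      ∫⁻ y in Ioo 0 x, ‖f x - f y‖ₑ / ENNReal.ofReal ((x - y) ^ (α + 1)) ≤ ENNReal.ofReal A)
    (hg1 : ∀ s t, 0 < s → s < t → t < T → |g t - g s| ≤ C * (t - s) ^ (1 - α))
    (hg2 : ∀ s t, 0 < s → s < t → t < T →
      ∫⁻ y in Ioo s t, ‖g y - g s‖ₑ / ENNReal.ofReal ((y - s) ^ (1 - α + 1)) ≤ ENNReal.ofReal C) :
    ∃ D, 0 ≤ D ∧ ∀ s t, 0 ≤ s → s ≤ t → t ≤ T →
      |fracStieltjes α 0 t f g - fracStieltjes α 0 s f g| ≤ D * (t - s) ^ (1 - α) := by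
  classical
  obtain ⟨G, hGm, hGg, hGl, hG1, hG2⟩ := exists_leftLim_extension (by linarith) hg1 hg2
  have hF : ∀ x, 0 < x → x ≤ T → (Icc 0 T).piecewise f 0 x = f x := fun x hx hxT =>
    piecewise_eq_of_mem _ _ _ ⟨hx.le, hxT⟩
  obtain ⟨D, hD, h⟩ := exists_holder_integral_weylDeriv hα hα1 hT hA hC
    (hf.measurable_piecewise (g := 0) continuousOn_const measurableSet_Icc) hGm
    (fun x hx hxT => by rw [hF x hx hxT]; exact hf1 x hx hxT)
    (fun x hx hxT => by
      rw [hF x hx hxT]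
      refine (le_of_eq ?_).trans (hf2 x hx hxT)
      refine setLIntegral_congr_fun measurableSet_Ioo fun y hy => ?_
      rw [hF y hy.1 (hy.2.le.trans hxT)])
    hG1 hG2
  have hcongr : ∀ t, 0 ≤ t → t ≤ T → fracStieltjes α 0 t f g = -∫ x in (0 : ℝ)..t,
      weylDerivLeft α 0 ((Icc 0 T).piecewise f 0) x *
        weylDerivRight (1 - α) t (fun u => G u - G t) x := by
    intro t ht htT
    rcases ht.eq_or_lt with rfl | ht'
    · simp [fracStieltjes]
    · exact fracStieltjes_eq_of_eqOn ht (fun x hx => (hF x hx.1 (hx.2.le.trans htT)).symm)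
        (fun x hx => (hGg x ⟨hx.1, hx.2.trans_le htT⟩).symm) (hGl t ⟨ht', htT⟩).symm
  refine ⟨D, hD, fun s t hs hst htT => ?_⟩
  rw [hcongr t (hs.trans hst) htT, hcongr s hs (hst.trans htT), neg_sub_neg, abs_sub_comm]
  exact h s t hs hst htT

/-! ### The regulator map. -/

theorem norm_le_card_mul {d : ℕ} {v : Vec d} {M : ℝ} (h : ∀ i, |v i| ≤ M) : ‖v‖ ≤ d * M := by
  have h1 : ‖v‖ ≤ ∑ i, |v i| := by
    rw [EuclideanSpace.norm_eq, Real.sqrt_le_left (Finset.sum_nonneg fun i _ => abs_nonneg _)]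
    simp only [Real.norm_eq_abs]
    exact Finset.sum_sq_le_sq_sum_of_nonneg fun i _ => abs_nonneg _
  refine h1.trans ((Finset.sum_le_sum fun i _ => h i).trans (le_of_eq ?_))
  simp

theorem abs_apply_le_norm {d : ℕ} (v : Vec d) (i : Fin d) : |v i| ≤ ‖v‖ := PiLp.norm_apply_le v i

/-- The componentwise running maximum of the negative part. -/
def regulator {d : ℕ} (z : ℝ → Vec d) (t : ℝ) : Vec d :=
  WithLp.toLp 2 fun i => sSup ((fun s => max (-(z s i)) 0) '' Icc 0 t)

theorem isRegulator_regulator {d : ℕ} {T : ℝ} {z : ℝ → Vec d} (hz : ContinuousOn z (Icc 0 T)) :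
    IsRegulator T z (regulator z) := by
  intro t ht i
  have hc : ContinuousOn (fun s => max (-(z s i)) 0) (Icc 0 t) := by
    have := hz.mono (Icc_subset_Icc_right ht.2)
    fun_prop
  exact (isCompact_Icc.image_of_continuousOn hc).isGreatest_sSup
    ((nonempty_Icc.2 ht.1).image _)

theorem max_neg_zero_le {a b M : ℝ} (h : |a - b| ≤ M) : max (-a) 0 ≤ max (-b) 0 + M := by
  have hM := (abs_nonneg _).trans h
  have := (abs_le.1 h).1
  refine max_le ?_ ?_
  · linarith [le_max_left (-b) 0]
  · linarith [le_max_right (-b) 0]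

/-- A running maximum of negative parts is 1-Lipschitz for the supremum norm in each component; the
factor `d` comes from summing the components. -/
theorem IsRegulator.norm_sub_le {d : ℕ} {T τ M : ℝ} {z z' y y' : ℝ → Vec d}
    (hy : IsRegulator T z y) (hy' : IsRegulator T z' y') (hτ : τ ∈ Icc 0 T)
    (h : ∀ s ∈ Icc 0 τ, ‖z s - z' s‖ ≤ M) : ‖y τ - y' τ‖ ≤ d * M := by
  have key : ∀ {z z' y y' : ℝ → Vec d}, IsRegulator T z y → IsRegulator T z' y' →
      (∀ s ∈ Icc 0 τ, ‖z s - z' s‖ ≤ M) → ∀ i, y τ i ≤ y' τ i + M := by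
    intro z z' y y' hy hy' h i
    obtain ⟨s, hs, he⟩ := (hy τ hτ i).1
    have h1 := (hy' τ hτ i).2 ⟨s, hs, rfl⟩
    have h2 : max (-(z s i)) 0 ≤ max (-(z' s i)) 0 + M :=
      max_neg_zero_le ((abs_apply_le_norm (z s - z' s) i).trans (h s hs))
    simp only at he h1
    linarith
  refine norm_le_card_mul fun i => abs_le.2 ⟨?_, ?_⟩
  · have := key hy' hy (fun s hs => by rw [norm_sub_rev]; exact h s hs) i
    simp only [PiLp.sub_apply]; linarith
  · have := key hy hy' h i
    simp only [PiLp.sub_apply]; linarith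

/-- The maximum over `[0,t]` is attained either before `s`, where nothing is gained, or at some `u ∈
[s,t]`, where the gain over the value at `s` is at most the oscillation of `z` there. -/
theorem IsRegulator.norm_sub_le_of_oscillation {d : ℕ} {T s t M : ℝ} {z y : ℝ → Vec d}
    (hy : IsRegulator T z y) (hs : 0 ≤ s) (hst : s ≤ t) (ht : t ≤ T)
    (h : ∀ u ∈ Icc s t, ‖z u - z s‖ ≤ M) : ‖y t - y s‖ ≤ d * M := by
  have hM : 0 ≤ M := (norm_nonneg _).trans (h s ⟨le_rfl, hst⟩)
  refine norm_le_card_mul fun i => abs_le.2 ⟨?_, ?_⟩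
  · obtain ⟨u, hu, he⟩ := (hy s ⟨hs, hst.trans ht⟩ i).1
    have h1 := (hy t ⟨hs.trans hst, ht⟩ i).2 ⟨u, ⟨hu.1, hu.2.trans hst⟩, rfl⟩
    simp only [PiLp.sub_apply] at he h1 ⊢; linarith
  · obtain ⟨u, hu, he⟩ := (hy t ⟨hs.trans hst, ht⟩ i).1
    simp only [PiLp.sub_apply] at he ⊢
    rcases le_total u s with hus | hus
    · have h1 := (hy s ⟨hs, hst.trans ht⟩ i).2 ⟨u, ⟨hu.1, hus⟩, rfl⟩
      simp only at h1; linarith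
    · have h1 := (hy s ⟨hs, hst.trans ht⟩ i).2 ⟨s, ⟨hs, le_rfl⟩, rfl⟩
      have h2 : max (-(z u i)) 0 ≤ max (-(z s i)) 0 + M :=
        max_neg_zero_le ((abs_apply_le_norm (z u - z s) i).trans (h u ⟨hus, hu.2⟩))
      simp only at h1; linarith

theorem IsRegulator.continuousOn {d : ℕ} {T : ℝ} {z y : ℝ → Vec d} (hy : IsRegulator T z y)
    (hz : ContinuousOn z (Icc 0 T)) : ContinuousOn y (Icc 0 T) := by
  have hu := isCompact_Icc.uniformContinuousOn_of_continuous hz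
  rw [Metric.uniformContinuousOn_iff] at hu
  rw [Metric.continuousOn_iff]
  intro t ht ε hε
  -- Dividing by `d + 1` keeps the final inequality strict and covers `d = 0`.
  obtain ⟨δ, hδ, h⟩ := hu (ε / (d + 1)) (by positivity)
  have key : ∀ s ∈ Icc 0 T, ∀ t ∈ Icc 0 T, s ≤ t → dist t s < δ → dist (y t) (y s) < ε := by
    intro s hs t ht hst hd
    rw [Real.dist_eq, abs_of_nonneg (by linarith)] at hd
    rw [dist_eq_norm]
    refine (hy.norm_sub_le_of_oscillation hs.1 hst ht.2 (M := ε / (d + 1)) fun u hu' => ?_).trans_lt ?_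
    · rw [← dist_eq_norm]
      refine (h u ⟨hs.1.trans hu'.1, hu'.2.trans ht.2⟩ s hs ?_).le
      rw [Real.dist_eq, abs_of_nonneg (by linarith [hu'.1])]
      linarith [hu'.2]
    · rw [mul_div_assoc', div_lt_iff₀ (by positivity)]
      linarith
  refine ⟨δ, hδ, fun u hu' hd => ?_⟩
  rcases le_total t u with h' | h'
  · exact key t ht u hu' h' hd
  · rw [dist_comm] at hd ⊢
    exact key u hu' t ht h' hd

theorem IsRegulator.eq_zero {d : ℕ} {T : ℝ} {z y : ℝ → Vec d} (hy : IsRegulator T z y) (hT : 0 ≤ T)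
    (hz : ∀ i, 0 ≤ z 0 i) : y 0 = 0 := by
  ext i
  obtain ⟨s, hs, he⟩ := (hy 0 ⟨le_rfl, hT⟩ i).1
  obtain rfl : s = 0 := le_antisymm hs.2 hs.1
  rw [← he]
  simpa using hz i

theorem IsRegulator.add_nonneg {d : ℕ} {T t : ℝ} {z y : ℝ → Vec d} (hy : IsRegulator T z y)
    (ht : t ∈ Icc 0 T) (i : Fin d) : 0 ≤ z t i + y t i := by
  have h1 := (hy t ht i).2 ⟨t, ⟨ht.1, le_rfl⟩, rfl⟩
  simp only at h1
  linarith [le_max_left (-(z t i)) 0]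

/-! ### The running supremum of a path. -/

theorem norm_apply_le_supNormUpTo {s t τ : ℝ} {d : ℕ} (x : PathSpace s t d) {u : Icc s t}
    (hu : (u : ℝ) ≤ τ) : ‖x u‖ ≤ supNormUpTo τ x :=
  le_csSup ⟨‖x‖, by rintro _ ⟨v, -, rfl⟩; exact x.norm_coe_le_norm v⟩ ⟨u, hu, rfl⟩

theorem supNormUpTo_le {s t τ M : ℝ} {d : ℕ} {x : PathSpace s t d} (hM : 0 ≤ M)
    (h : ∀ u : Icc s t, (u : ℝ) ≤ τ → ‖x u‖ ≤ M) : supNormUpTo τ x ≤ M :=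
  Real.sSup_le (by rintro _ ⟨v, hv, rfl⟩; exact h v hv) hM

theorem supNormUpTo_le_norm {s t τ : ℝ} {d : ℕ} (x : PathSpace s t d) : supNormUpTo τ x ≤ ‖x‖ :=
  supNormUpTo_le (norm_nonneg _) fun u _ => x.norm_coe_le_norm u

theorem norm_le_supNormUpTo {s t τ : ℝ} {d : ℕ} (x : PathSpace s t d) (hτ : t ≤ τ) :
    ‖x‖ ≤ supNormUpTo τ x :=
  (ContinuousMap.norm_le _ (Real.sSup_nonneg (by rintro _ ⟨v, -, rfl⟩; exact norm_nonneg _))).2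
    fun u => norm_apply_le_supNormUpTo x (u.2.2.trans hτ)

/-! ### The reflected drift equation with a prescribed forcing. -/

section Drift

variable {d : ℕ} {r T ρ : ℝ} {b : ℝ → PathSpace (-r) T d → Vec d}

theorem HypH2.aestronglyMeasurable (hb : HypH2 r T ρ b) (x : PathSpace (-r) T d) :
    AEStronglyMeasurable (fun s => b s x) (volume.restrict (Icc 0 T)) := by
  let _ : MeasurableSpace (PathSpace (-r) T d) := borel _
  have h : Measurable fun s : Icc (0 : ℝ) T => b s x := hb.measurable.comp measurable_prodMk_right
  exact (aemeasurable_restrict_of_measurable_subtype measurableSet_Icc h).aestronglyMeasurable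

theorem integrableOn_Icc_of_memLp (hρ : 2 ≤ ρ) {b₀ : ℝ → ℝ}
    (h : MemLp b₀ (ENNReal.ofReal ρ) (volume.restrict (Icc 0 T))) : IntegrableOn b₀ (Icc 0 T) :=
  h.integrable (by rw [ENNReal.one_le_ofReal]; linarith)

theorem HypH2.integrableOn (hb : HypH2 r T ρ b) (x : PathSpace (-r) T d) :
    IntegrableOn (fun s => b s x) (Icc 0 T) := by
  obtain ⟨b₀, L, hb₀, hL, -, hgrowth⟩ := hb.bounds
  have hi : IntegrableOn (fun s => L 0 * ‖x‖ + b₀ s) (Icc 0 T) :=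
    (integrableOn_const (by simp)).add (integrableOn_Icc_of_memLp hb.two_le hb₀)
  refine Integrable.mono' hi (hb.aestronglyMeasurable x) ?_
  refine (ae_restrict_mem measurableSet_Icc).mono fun s hs => (hgrowth x s hs).trans ?_
  have := hL 0 le_rfl
  gcongr
  exact supNormUpTo_le_norm x

theorem HypH2.intervalIntegrable (hb : HypH2 r T ρ b) (x : PathSpace (-r) T d) {s t : ℝ}
    (hs : s ∈ Icc 0 T) (ht : t ∈ Icc 0 T) : IntervalIntegrable (fun u => b u x) volume s t :=
  ((hb.integrableOn x).mono_set (uIcc_subset_Icc hs ht)).intervalIntegrable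

theorem HypH2.continuousOn_integral (hb : HypH2 r T ρ b) (hT : 0 ≤ T) (x : PathSpace (-r) T d) :
    ContinuousOn (fun t => ∫ s in (0 : ℝ)..t, b s x) (Icc 0 T) := by
  rw [← uIcc_of_le hT]
  refine intervalIntegral.continuousOn_primitive_interval ?_
  rw [uIcc_of_le hT]
  exact hb.integrableOn x

/-- The unreflected process driven by the path `x` and the forcing `h`. -/
def unreflectedPath (b : ℝ → PathSpace (-r) T d → Vec d) (η h : ℝ → Vec d) (x : PathSpace (-r) T d)
    (t : ℝ) : Vec d :=
  η 0 + (∫ s in (0 : ℝ)..t, b s x) + h t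

/-- The path `u` starts with `η` and continues as the normal reflection of the unreflected process
driven by `x` and `h`. -/
structure IsReflectedImage (b : ℝ → PathSpace (-r) T d → Vec d) (η h : ℝ → Vec d)
    (x u : PathSpace (-r) T d) : Prop where
  initial : ∀ t : Icc (-r) T, (t : ℝ) ≤ 0 → u t = η t
  equation : ∃ y : ℝ → Vec d, IsRegulator T (unreflectedPath b η h x) y ∧
    ∀ t : Icc (-r) T, 0 < (t : ℝ) → u t = unreflectedPath b η h x t + y t

variable {η h h' : ℝ → Vec d} {x x' u u' : PathSpace (-r) T d}

theorem HypH2.continuousOn_unreflectedPath (hb : HypH2 r T ρ b) (hT : 0 ≤ T)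
    (hh : ContinuousOn h (Icc 0 T))
    (x : PathSpace (-r) T d) : ContinuousOn (unreflectedPath b η h x) (Icc 0 T) :=
  (continuousOn_const.add (hb.continuousOn_integral hT x)).add hh

theorem HypH2.exists_isReflectedImage (hb : HypH2 r T ρ b) (hr : 0 < r) (hT : 0 < T)
    (hη : ContinuousOn η (Icc (-r) 0)) (hη0 : ∀ i, 0 ≤ η 0 i) (hh : ContinuousOn h (Icc 0 T))
    (hh0 : h 0 = 0) (x : PathSpace (-r) T d) : ∃ u, IsReflectedImage b η h x u := by
  have hz := hb.continuousOn_unreflectedPath (η := η) hT.le hh x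
  have hy := isRegulator_regulator hz
  set y := regulator (unreflectedPath b η h x)
  have hz0 : unreflectedPath b η h x 0 = η 0 := by simp [unreflectedPath, hh0]
  have hy0 : y 0 = 0 := hy.eq_zero hT.le (by rwa [hz0])
  -- Both pieces take the value `η 0` at time `0`, since `h` and `y` vanish there; subtracting `η 0`
  -- once glues them into a single continuous formula.
  have hc : Continuous fun t : Icc (-r) T => η (min (t : ℝ) 0) - η 0 +
      (unreflectedPath b η h x (max (t : ℝ) 0) + y (max (t : ℝ) 0)) := by
    refine ((hη.comp_continuous (by fun_prop) fun t => ?_).sub continuous_const).add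
      ((hz.add (hy.continuousOn hz)).comp_continuous (by fun_prop) fun t => ?_)
    · exact ⟨le_min t.2.1 (by linarith), min_le_right _ _⟩
    · exact ⟨le_max_right _ _, max_le t.2.2 hT.le⟩
  refine ⟨⟨_, hc⟩, ⟨fun t ht => ?_, y, hy, fun t ht => ?_⟩⟩
  · simp [min_eq_left ht, max_eq_right ht, hz0, hy0]
  · simp [min_eq_right ht.le, max_eq_left ht.le]

/-- One Picard step: integrating the Lipschitz bound raises the power of `t` by one. In `1 + d`, the
`1` is the unreflected path and the `d` its regulator. -/
theorem IsReflectedImage.supNormUpTo_sub_le (hb : HypH2 r T ρ b)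
    (hu : IsReflectedImage b η h x u) (hu' : IsReflectedImage b η h' x' u') {τ L c : ℝ} {n : ℕ}
    (hτ : τ ≤ T) (hL : 0 ≤ L) (hc : 0 ≤ c) (hhh : ∀ t ∈ Icc 0 τ, h t = h' t)
    (hlip : ∀ t ∈ Icc 0 T, ‖b t x - b t x'‖ ≤ L * supNormUpTo t (x - x'))
    (hx : ∀ t ∈ Icc 0 τ, supNormUpTo t (x - x') ≤ c * t ^ n) :
    ∀ t ∈ Icc 0 τ, supNormUpTo t (u - u') ≤ (1 + d) * L * c / (n + 1) * t ^ (n + 1) := by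
  intro t ht
  have hz : ∀ s ∈ Icc 0 t, ‖unreflectedPath b η h x s - unreflectedPath b η h' x' s‖ ≤
      L * c / (n + 1) * s ^ (n + 1) := by
    intro s hs
    have hsT : s ∈ Icc 0 T := ⟨hs.1, hs.2.trans (ht.2.trans hτ)⟩
    have h0T : (0 : ℝ) ∈ Icc 0 T := ⟨le_rfl, hsT.1.trans hsT.2⟩
    unfold unreflectedPath
    rw [hhh s ⟨hs.1, hs.2.trans ht.2⟩, add_sub_add_right_eq_sub, add_sub_add_left_eq_sub,
      ← intervalIntegral.integral_sub (hb.intervalIntegrable x h0T hsT)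
        (hb.intervalIntegrable x' h0T hsT)]
    have hi : IntervalIntegrable (fun v : ℝ => L * (c * v ^ n)) volume 0 s :=
      Continuous.intervalIntegrable (by fun_prop) _ _
    refine (intervalIntegral.norm_integral_le_of_norm_le hs.1 (ae_of_all _ fun v hv => ?_) hi).trans ?_
    · refine (hlip v ⟨hv.1.le, hv.2.trans hsT.2⟩).trans ?_
      gcongr
      exact hx v ⟨hv.1.le, hv.2.trans (hs.2.trans ht.2)⟩
    · rw [intervalIntegral.integral_const_mul, intervalIntegral.integral_const_mul, integral_pow]
      apply le_of_eq
      simp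
      ring
  have hM : ∀ s, 0 ≤ s → s ≤ t → L * c / (n + 1) * s ^ (n + 1) ≤ L * c / (n + 1) * t ^ (n + 1) :=
    fun s hs hst => by gcongr
  have ht0 := ht.1
  refine supNormUpTo_le (by positivity) fun s hst => ?_
  obtain ⟨y, hy, huy⟩ := hu.equation
  obtain ⟨y', hy', huy'⟩ := hu'.equation
  rcases le_or_gt (s : ℝ) 0 with hs | hs
  · rw [ContinuousMap.sub_apply, hu.initial s hs, hu'.initial s hs, sub_self, norm_zero]
    positivity
  · rw [ContinuousMap.sub_apply, huy s hs, huy' s hs, add_sub_add_comm]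
    have h1 := (hz s ⟨hs.le, hst⟩).trans (hM s hs.le hst)
    have h2 := hy.norm_sub_le hy' ⟨hs.le, s.2.2⟩ fun v hv =>
      (hz v ⟨hv.1, hv.2.trans hst⟩).trans (hM v hv.1 (hv.2.trans hst))
    calc _ ≤ _ := norm_add_le _ _
      _ ≤ _ := add_le_add h1 h2
      _ = _ := by ring

/-- The ball with weight `exp (l * t)` is invariant. The linear part of the drift integrates to at
most `L * R / l * exp (l * t)`, so after reflection it uses at most half of the radius once `l ≥ 2
(1 + d) L`; the data use the other half. -/
theorem IsReflectedImage.supNormUpTo_le_exp (hu : IsReflectedImage b η h x u)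
    {b₀ : ℝ → ℝ} {L H E l R : ℝ} (hT : 0 ≤ T) (hL : 0 ≤ L)
    (hl : 0 < l) (hR : 0 ≤ R)
    (hb₀ : IntegrableOn b₀ (Icc 0 T))
    (hgrowth : ∀ t ∈ Icc 0 T, ‖b t x‖ ≤ L * supNormUpTo t x + b₀ t)
    (hη : ∀ t ∈ Icc (-r) 0, ‖η t‖ ≤ E) (hη0 : ‖η 0‖ ≤ E) (hH : ∀ t ∈ Icc 0 T, ‖h t‖ ≤ H)
    (hER : E ≤ R) (hA : 2 * (1 + d) * (E + (∫ s in (0 : ℝ)..T, |b₀ s|) + H) ≤ R)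
    (hlL : 2 * (1 + d) * L ≤ l)
    (hx : ∀ t ∈ Icc 0 T, supNormUpTo t x ≤ R * Real.exp (l * t)) :
    ∀ t ∈ Icc 0 T, supNormUpTo t u ≤ R * Real.exp (l * t) := by
  have hab : IntervalIntegrable (fun s => |b₀ s|) volume 0 T := by
    refine IntegrableOn.intervalIntegrable ?_
    rw [uIcc_of_le hT]
    exact hb₀.abs
  have hz : ∀ s ∈ Icc 0 T, ‖unreflectedPath b η h x s‖ ≤
      (E + (∫ s in (0 : ℝ)..T, |b₀ s|) + H) + L * R / l * Real.exp (l * s) := by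
    intro s hs
    have hsub : IntervalIntegrable (fun s => |b₀ s|) volume 0 s :=
      hab.mono_set (by rw [uIcc_of_le hs.1, uIcc_of_le hT]; exact Icc_subset_Icc_right hs.2)
    have hexp : IntervalIntegrable (fun v => L * R * Real.exp (l * v)) volume 0 s :=
      Continuous.intervalIntegrable (by fun_prop) _ _
    have hI : ‖∫ v in (0 : ℝ)..s, b v x‖ ≤
        L * R / l * Real.exp (l * s) + ∫ s in (0 : ℝ)..T, |b₀ s| := by
      refine (intervalIntegral.norm_integral_le_of_norm_le hs.1 (ae_of_all _ fun v hv => ?_)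
        (hexp.add hsub)).trans ?_
      · have hvT : v ∈ Icc 0 T := ⟨hv.1.le, hv.2.trans hs.2⟩
        refine (hgrowth v hvT).trans ?_
        rw [mul_assoc]
        gcongr
        · exact hx v hvT
        · exact le_abs_self _
      · rw [intervalIntegral.integral_add hexp hsub]
        gcongr
        · rw [intervalIntegral.integral_const_mul, intervalIntegral.integral_comp_mul_left
            (fun v => Real.exp v) hl.ne', integral_exp]
          simp only [mul_zero, Real.exp_zero, smul_eq_mul]
          have : 0 ≤ L * R / l := by positivity
          calc L * R * (l⁻¹ * (Real.exp (l * s) - 1)) = L * R / l * Real.exp (l * s) - L * R / l := by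
                field_simp
            _ ≤ _ := by linarith
        · exact intervalIntegral.integral_mono_interval le_rfl hs.1 hs.2
            (ae_of_all _ fun v => abs_nonneg _) hab
    unfold unreflectedPath
    calc _ ≤ ‖η 0‖ + ‖∫ v in (0 : ℝ)..s, b v x‖ + ‖h s‖ := norm_add₃_le
      _ ≤ E + (L * R / l * Real.exp (l * s) + ∫ s in (0 : ℝ)..T, |b₀ s|) + H := by
        gcongr
        exact hH s hs
      _ = _ := by ring
  intro t ht
  refine supNormUpTo_le (by positivity) fun s hst => ?_
  have hR1 : R ≤ R * Real.exp (l * t) :=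
    le_mul_of_one_le_right hR (Real.one_le_exp (mul_nonneg hl.le ht.1))
  obtain ⟨y, hy, huy⟩ := hu.equation
  rcases le_or_gt (s : ℝ) 0 with hs | hs
  · rw [hu.initial s hs]
    exact ((hη s ⟨s.2.1, hs⟩).trans hER).trans hR1
  · rw [huy s hs]
    -- Comparison with the zero path turns the Lipschitz estimate into a bound on `y` itself.
    have hreg0 : IsRegulator T (fun _ => (0 : Vec d)) (fun _ => 0) := fun v hv i =>
      ⟨⟨0, ⟨le_rfl, hv.1⟩, by simp⟩, by rintro _ ⟨w, -, rfl⟩; simp⟩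
    have hmono : ∀ v, v ≤ (s : ℝ) → (E + (∫ s in (0 : ℝ)..T, |b₀ s|) + H) +
        L * R / l * Real.exp (l * v) ≤
        (E + (∫ s in (0 : ℝ)..T, |b₀ s|) + H) + L * R / l * Real.exp (l * t) := fun v hv => by
      gcongr; exact hv.trans hst
    have h1 := (hz s ⟨hs.le, s.2.2⟩).trans (hmono s le_rfl)
    have h2 := hy.norm_sub_le hreg0 ⟨hs.le, s.2.2⟩ fun v hv => by
      rw [sub_zero]
      exact (hz v ⟨hv.1, hv.2.trans s.2.2⟩).trans (hmono v hv.2)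
    rw [sub_zero] at h2
    have h3 : (1 + d) * (L * R / l) ≤ R / 2 := by
      rw [mul_div_assoc', div_le_div_iff₀ hl (by norm_num)]
      nlinarith
    have h4 := mul_le_mul_of_nonneg_right h3 (Real.exp_pos (l * t)).le
    calc _ ≤ _ := norm_add_le _ _
      _ ≤ _ := add_le_add h1 h2
      _ = (1 + d) * (E + (∫ s in (0 : ℝ)..T, |b₀ s|) + H) +
          (1 + d) * (L * R / l) * Real.exp (l * t) := by ring
      _ ≤ _ := by linarith

/-- Two sequences are allowed so that one estimate serves both purposes: constant sequences give
uniqueness, a sequence and its shift give convergence. -/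
theorem IsReflectedImage.supNormUpTo_iterate_le (hb : HypH2 r T ρ b) {x u : ℕ → PathSpace (-r) T d}
    (hu : ∀ n, IsReflectedImage b η h (x n) (x (n + 1)))
    (hu' : ∀ n, IsReflectedImage b η h' (u n) (u (n + 1))) {τ L M : ℝ}
    (hτ : τ ≤ T) (hL : 0 ≤ L) (hM : 0 ≤ M) (hhh : ∀ t ∈ Icc 0 τ, h t = h' t)
    (hlip : ∀ n, ∀ t ∈ Icc 0 T, ‖b t (x n) - b t (u n)‖ ≤ L * supNormUpTo t (x n - u n))
    (hx : ‖x 0 - u 0‖ ≤ M) (n : ℕ) :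
    ∀ t ∈ Icc 0 τ, supNormUpTo t (x n - u n) ≤
      M * (((1 + d) * L) ^ n / n.factorial) * t ^ n := by
  induction n with
  | zero => intro t _; simpa using (supNormUpTo_le_norm _).trans hx
  | succ n ih =>
    intro t ht
    refine ((hu n).supNormUpTo_sub_le hb (hu' n) hτ hL (by positivity) hhh (hlip n) ih t ht).trans
      (le_of_eq ?_)
    congr 1
    rw [Nat.factorial_succ]
    push_cast
    field_simp
    ring

theorem tendsto_mul_pow_div_factorial (M K t : ℝ) :
    Tendsto (fun n : ℕ => M * (K ^ n / n.factorial) * t ^ n) atTop (𝓝 0) := by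
  have := (FloorSemiring.tendsto_pow_div_factorial_atTop (K * t)).const_mul M
  rw [mul_zero] at this
  refine this.congr fun n => ?_
  rw [mul_pow]; ring

/-- Two solutions agree up to time `τ` if their forcings do. -/
theorem IsReflectedImage.eq_of_forcing_eq (hb : HypH2 r T ρ b) (hx : IsReflectedImage b η h x x)
    (hx' : IsReflectedImage b η h' x' x') {τ : ℝ} (hτ : τ ∈ Icc 0 T)
    (hhh : ∀ t ∈ Icc 0 τ, h t = h' t) (t : Icc (-r) T) (ht : (t : ℝ) ≤ τ) : x t = x' t := by
  obtain ⟨b₀, L, hb₀, hL, hlip, hgrowth⟩ := hb.bounds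
  -- Both paths are bounded, so one local Lipschitz constant applies to them.
  have hN : 0 ≤ max ‖x‖ ‖x'‖ := (norm_nonneg _).trans (le_max_left _ _)
  have hle := IsReflectedImage.supNormUpTo_iterate_le hb (x := fun _ => x) (u := fun _ => x')
    (fun _ => hx) (fun _ => hx') hτ.2 (hL _ hN).le (norm_nonneg _) hhh
    (fun _ t ht => hlip _ hN x x' (le_max_left _ _) (le_max_right _ _) t ht) le_rfl
  have h0 : supNormUpTo τ (x - x') ≤ 0 :=
    ge_of_tendsto' (tendsto_mul_pow_div_factorial _ _ _) fun n => hle n τ ⟨hτ.1, le_rfl⟩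
  have := (norm_apply_le_supNormUpTo (x - x') ht).trans h0
  rwa [norm_le_zero_iff, ContinuousMap.sub_apply, sub_eq_zero] at this

/-- Existence of a solution with a given continuous forcing. -/
theorem HypH2.exists_isReflectedImage_self (hb : HypH2 r T ρ b) (hr : 0 < r) (hT : 0 < T)
    (hη : ContinuousOn η (Icc (-r) 0)) (hη0 : ∀ i, 0 ≤ η 0 i) (hh : ContinuousOn h (Icc 0 T))
    (hh0 : h 0 = 0) : ∃ x, IsReflectedImage b η h x x := by
  choose Φ hΦ using fun x => hb.exists_isReflectedImage (η := η) hr hT hη hη0 hh hh0 x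
  obtain ⟨b₀, L, hb₀, hL, hlip, hgrowth⟩ := hb.bounds
  obtain ⟨E, hE⟩ := isCompact_Icc.exists_bound_of_continuousOn hη
  obtain ⟨H, hH⟩ := isCompact_Icc.exists_bound_of_continuousOn hh
  have hE0 := hE 0 ⟨by linarith, le_rfl⟩
  have hE' : 0 ≤ E := (norm_nonneg _).trans hE0
  have hH' : 0 ≤ H := (norm_nonneg _).trans (hH 0 ⟨le_rfl, hT.le⟩)
  have hL0 := hL 0 le_rfl
  have hI : 0 ≤ ∫ s in (0 : ℝ)..T, |b₀ s| :=
    intervalIntegral.integral_nonneg hT.le fun _ _ => abs_nonneg _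
  set R := max E (2 * (1 + d) * (E + (∫ s in (0 : ℝ)..T, |b₀ s|) + H)) with hRdef
  set l := 2 * (1 + d) * L 0 with hl
  have hl0 : 0 < l := by positivity
  have hR : 0 ≤ R := hE'.trans (le_max_left _ _)
  have hinv : ∀ x, (∀ t ∈ Icc 0 T, supNormUpTo t x ≤ R * Real.exp (l * t)) →
      ∀ t ∈ Icc 0 T, supNormUpTo t (Φ x) ≤ R * Real.exp (l * t) := fun x hx =>
    (hΦ x).supNormUpTo_le_exp hT.le hL0.le hl0 hR (integrableOn_Icc_of_memLp hb.two_le hb₀)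
      (fun t ht => hgrowth x t ht) hE hE0 hH (le_max_left _ _) (le_max_right _ _) le_rfl hx
  let X : ℕ → PathSpace (-r) T d := fun n => Φ^[n] 0
  have hXs : ∀ n, X (n + 1) = Φ (X n) := fun n => Function.iterate_succ_apply' Φ n 0
  have hXb : ∀ n, ∀ t ∈ Icc 0 T, supNormUpTo t (X n) ≤ R * Real.exp (l * t) := by
    intro n
    induction n with
    | zero => intro t _; exact supNormUpTo_le (by positivity) fun u _ => by simp [X]; positivity
    | succ n ih => rw [hXs]; exact hinv _ ih
  -- A bound common to all iterates, so that `L N` is a Lipschitz constant along the whole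
  -- iteration.
  set N := R * Real.exp (l * T)
  have hN : 0 ≤ N := by positivity
  have hXN : ∀ n, ‖X n‖ ≤ N := fun n =>
    (norm_le_supNormUpTo _ le_rfl).trans (hXb n T ⟨hT.le, le_rfl⟩)
  have himg : ∀ n, IsReflectedImage b η h (X n) (X (n + 1)) := fun n => by rw [hXs]; exact hΦ _
  have hdist : ∀ n, dist (X n) (X n.succ) ≤
      ‖X 0 - X 1‖ * (((1 + d) * L N * T) ^ n / n.factorial) := by
    intro n
    have := IsReflectedImage.supNormUpTo_iterate_le hb (x := X) (u := fun n => X (n + 1)) himg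
      (fun n => himg (n + 1)) le_rfl (hL N hN).le (norm_nonneg (X 0 - X 1)) (fun _ _ => rfl)
      (fun n => hlip N hN _ _ (hXN n) (hXN (n + 1))) le_rfl n T ⟨hT.le, le_rfl⟩
    rw [dist_eq_norm]
    refine ((norm_le_supNormUpTo _ le_rfl).trans this).trans (le_of_eq ?_)
    rw [mul_pow _ T]; ring
  obtain ⟨x, hx⟩ := cauchySeq_tendsto_of_complete (cauchySeq_of_dist_le_of_summable _ hdist
    ((Real.summable_pow_div_factorial _).mul_left _))
  have hxN : ‖x‖ ≤ N := le_of_tendsto' hx.norm hXN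
  -- The Picard step with exponent `0` shows that `Φ (X n)` tends to `Φ x`, so the limit is a fixed
  -- point.
  have hstep : ∀ n, ‖Φ x - X (n + 1)‖ ≤ (1 + d) * L N * T * ‖x - X n‖ := by
    intro n
    have := (hΦ x).supNormUpTo_sub_le hb (himg n) (n := 0) le_rfl (hL N hN).le
      (norm_nonneg (x - X n)) (fun _ _ => rfl) (hlip N hN _ _ hxN (hXN n))
      (fun t _ => by simpa using supNormUpTo_le_norm _) T ⟨hT.le, le_rfl⟩
    refine ((norm_le_supNormUpTo _ le_rfl).trans this).trans (le_of_eq ?_)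
    simp; ring
  have h0 : Tendsto (fun n => (1 + d) * L N * T * ‖x - X n‖) atTop (𝓝 0) := by
    simpa using ((hx.const_sub x).norm).const_mul ((1 + d) * L N * T)
  have h1 : ‖Φ x - x‖ ≤ 0 :=
    le_of_tendsto_of_tendsto' ((hx.comp (tendsto_add_atTop_nat 1)).const_sub (Φ x)).norm h0 hstep
  rw [norm_le_zero_iff, sub_eq_zero] at h1
  refine ⟨x, ?_⟩
  have := hΦ x
  rwa [h1] at this

/-- Hölder's inequality against the constant `1`, with conjugate exponents `1 / α` and `1 / (1 -
α)`; `B` is the `L^{1/α}` norm on `[0,T]`. The choice `ρ = 1 / α` gives the drift the same Hölder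
exponent as the rough integral. -/
theorem exists_integral_abs_le_of_memLp {α : ℝ} (hα : 0 < α) (hα1 : α < 1) {b₀ : ℝ → ℝ}
    (h : MemLp b₀ (ENNReal.ofReal (1 / α)) (volume.restrict (Icc 0 T))) :
    ∃ B, 0 ≤ B ∧ ∀ s t, 0 ≤ s → s ≤ t → t ≤ T → ∫ v in s..t, |b₀ v| ≤ B * (t - s) ^ (1 - α) := by
  have hconj : (1 / α).HolderConjugate (1 / (1 - α)) := by
    rw [Real.holderConjugate_iff]
    refine ⟨by rw [lt_div_iff₀ hα]; linarith, by field_simp; ring⟩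
  refine ⟨(∫ v in Icc 0 T, |b₀ v| ^ (1 / α)) ^ (1 / (1 / α)), by positivity, fun s t hs hst ht => ?_⟩
  have hsub : Ioc s t ⊆ Icc 0 T := fun v hv => ⟨hs.trans hv.1.le, hv.2.trans ht⟩
  have hle : volume.restrict (Ioc s t) ≤ volume.restrict (Icc 0 T) := Measure.restrict_mono_set _ hsub
  have h2 := integral_mul_le_Lp_mul_Lq_of_nonneg (μ := volume.restrict (Ioc s t)) hconj
    (f := fun v => |b₀ v|) (g := fun _ => 1) (ae_of_all _ fun v => abs_nonneg _)
    (ae_of_all _ fun v => zero_le_one) (h.mono_measure hle).norm (memLp_const 1)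
  simp only [mul_one, Real.one_rpow, integral_const, smul_eq_mul, measureReal_restrict_apply_univ,
    Real.volume_real_Ioc_of_le hst] at h2
  rw [intervalIntegral.integral_of_le hst]
  refine h2.trans ?_
  rw [one_div_one_div (1 - α)]
  have hp : 0 ≤ (t - s) ^ (1 - α) := Real.rpow_nonneg (by linarith) _
  refine mul_le_mul_of_nonneg_right (Real.rpow_le_rpow
    (integral_nonneg fun v => Real.rpow_nonneg (abs_nonneg _) _) ?_ (by positivity)) hp
  have hi := h.norm.integrable_norm_rpow (by simp [hα]) (by simp)
  rw [ENNReal.toReal_ofReal (by positivity)] at hi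
  have hi' : IntegrableOn (fun v => |b₀ v| ^ (1 / α)) (Icc 0 T) := by
    simpa [IntegrableOn] using hi
  exact setIntegral_mono_set hi' (ae_of_all _ fun v => Real.rpow_nonneg (abs_nonneg _) _)
    hsub.eventuallyLE

/-- A solution is `(1-α)`-Hölder on `[0,T]` if its forcing is. -/
theorem IsReflectedImage.exists_holder {α D : ℝ} (hα : 0 < α) (hα1 : α < 1)
    (hb : HypH2 r T (1 / α) b) (hT : 0 < T) (hη0 : ∀ i, 0 ≤ η 0 i) (hh0 : h 0 = 0)
    (hD : 0 ≤ D)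
    (hh : ∀ s t, 0 ≤ s → s ≤ t → t ≤ T → ‖h t - h s‖ ≤ D * (t - s) ^ (1 - α))
    (hx : IsReflectedImage b η h x u) :
    ∃ K, 0 ≤ K ∧ ∀ s t : Icc (-r) T, 0 ≤ (s : ℝ) → (s : ℝ) ≤ t →
      ‖u t - u s‖ ≤ K * ((t : ℝ) - s) ^ (1 - α) := by
  obtain ⟨b₀, L, hb₀, hL, hlip, hgrowth⟩ := hb.bounds
  obtain ⟨B, hB0, hB⟩ := exists_integral_abs_le_of_memLp hα hα1 hb₀
  have hL0 := hL 0 le_rfl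
  have hz : ∀ s t, 0 ≤ s → s ≤ t → t ≤ T → ‖unreflectedPath b η h x t - unreflectedPath b η h x s‖ ≤
      (L 0 * ‖x‖ * T ^ α + B + D) * (t - s) ^ (1 - α) := by
    intro s t hs hst ht
    have h0T : (0 : ℝ) ∈ Icc 0 T := ⟨le_rfl, hT.le⟩
    have hsT : s ∈ Icc 0 T := ⟨hs, hst.trans ht⟩
    have htT : t ∈ Icc 0 T := ⟨hs.trans hst, ht⟩
    have hsplit : unreflectedPath b η h x t - unreflectedPath b η h x s =
        (∫ v in s..t, b v x) + (h t - h s) := by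
      rw [← intervalIntegral.integral_interval_sub_left (hb.intervalIntegrable x h0T htT)
        (hb.intervalIntegrable x h0T hsT)]
      unfold unreflectedPath
      abel
    have hab : IntervalIntegrable (fun v => |b₀ v|) volume s t :=
      IntegrableOn.intervalIntegrable
        ((integrableOn_Icc_of_memLp hb.two_le hb₀).mono_set (uIcc_subset_Icc hsT htT)).abs
    have hI : ‖∫ v in s..t, b v x‖ ≤ L 0 * ‖x‖ * (t - s) + B * (t - s) ^ (1 - α) := by
      refine (intervalIntegral.norm_integral_le_of_norm_le hst (ae_of_all _ fun v hv => ?_)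
        ((intervalIntegrable_const (c := L 0 * ‖x‖)).add hab)).trans ?_
      · refine (hgrowth x v ⟨hs.trans hv.1.le, hv.2.trans ht⟩).trans ?_
        gcongr
        · exact supNormUpTo_le_norm x
        · exact le_abs_self _
      · rw [intervalIntegral.integral_add intervalIntegrable_const hab,
          intervalIntegral.integral_const, smul_eq_mul, mul_comm (t - s)]
        gcongr
        exact hB s t hs hst ht
    have hpow : t - s ≤ T ^ α * (t - s) ^ (1 - α) := by
      rcases hst.eq_or_lt with rfl | hlt
      · simp [Real.zero_rpow (show 1 - α ≠ 0 by linarith)]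
      calc t - s = (t - s) ^ α * (t - s) ^ (1 - α) := by
            rw [← Real.rpow_add (by linarith)]; simp
        _ ≤ _ := by gcongr; linarith
    rw [hsplit]
    calc _ ≤ _ := norm_add_le _ _
      _ ≤ (L 0 * ‖x‖ * (T ^ α * (t - s) ^ (1 - α)) + B * (t - s) ^ (1 - α)) +
          D * (t - s) ^ (1 - α) := by
        refine add_le_add (hI.trans ?_) (hh s t hs hst ht)
        gcongr
      _ = _ := by ring
  obtain ⟨y, hy, huy⟩ := hx.equation
  have hz0 : unreflectedPath b η h x 0 = η 0 := by simp [unreflectedPath, hh0]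
  -- The equation is given only for `t > 0`; it extends to `t = 0` because the regulator of a path
  -- starting in the orthant starts at zero.
  have hu : ∀ t : Icc (-r) T, 0 ≤ (t : ℝ) → u t = unreflectedPath b η h x t + y t := by
    intro t ht
    rcases ht.eq_or_lt with h | h
    · rw [hx.initial t h.symm.le, ← h, hz0, hy.eq_zero hT.le (by rwa [hz0]), add_zero]
    · exact huy t h
  refine ⟨(1 + d) * (L 0 * ‖x‖ * T ^ α + B + D), by positivity, fun s t hs hst => ?_⟩
  rw [hu t (hs.trans hst), hu s hs, add_sub_add_comm]
  have h1 := hz s t hs hst t.2.2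
  have h2 := hy.norm_sub_le_of_oscillation hs hst t.2.2 fun v hv =>
    (hz s v hs hv.1 (hv.2.trans t.2.2)).trans (by
      gcongr
      · linarith [hv.1]
      · exact hv.2 :
      _ ≤ (L 0 * ‖x‖ * T ^ α + B + D) * ((t : ℝ) - s) ^ (1 - α))
  calc _ ≤ _ := norm_add_le _ _
    _ ≤ _ := add_le_add h1 h2
    _ = _ := by ring

end Drift

/-! ### Hölder paths in `W_0^{α,∞}` and norm bounds for components. -/

theorem lintegral_Ioo_sub_rpow {p a u : ℝ} (hp : -1 < p) (hau : a ≤ u) :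
    ∫⁻ v in Ioo a u, ENNReal.ofReal ((u - v) ^ p) = ENNReal.ofReal ((u - a) ^ (p + 1) / (p + 1)) := by
  have hi : IntervalIntegrable (fun v => (u - v) ^ p) volume a u := by
    simpa using ((intervalIntegral.intervalIntegrable_rpow' (a := 0) (b := u - a) hp).comp_sub_left u).symm
  have hI : ∫ v in a..u, (u - v) ^ p = (u - a) ^ (p + 1) / (p + 1) := by
    rw [intervalIntegral.integral_comp_sub_left (fun v => v ^ p), integral_rpow (Or.inl hp), sub_self,
      Real.zero_rpow (by linarith), sub_zero]
  rw [intervalIntegrable_iff_integrableOn_Ioo_of_le hau] at hi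
  rw [← hI, intervalIntegral.integral_of_le hau, integral_Ioc_eq_integral_Ioo,
    ofReal_integral_eq_lintegral_ofReal hi]
  refine (ae_restrict_mem measurableSet_Ioo).mono fun v hv => ?_
  exact Real.rpow_nonneg (by linarith [hv.2]) _

theorem le_normAlphaInf {F : Type*} [NormedAddCommGroup F] {α s t u : ℝ} (f : ℝ → F)
    (hu : u ∈ Icc s t) :
    ‖f u‖ₑ + ∫⁻ v in Ioo s u, ‖f u - f v‖ₑ / ENNReal.ofReal ((u - v) ^ (α + 1)) ≤
      normAlphaInf α s t f :=
  le_iSup₂_of_le u hu le_rfl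

/-- Concatenation of a path in `W_0^{α,∞}(-r,0)` with a path that is `(1-α)`-Hölder on `[0,T]`. -/
theorem memW0_of_holder {d : ℕ} {α r T K : ℝ} {F : ℝ → Vec d} (hα : 0 < α) (hα2 : α < 1 / 2)
    (hr : 0 < r) (hF : Continuous F) (hE : normAlphaInf α (-r) 0 F < ∞) (hK : 0 ≤ K)
    (hH : ∀ s t, 0 ≤ s → s ≤ t → t ≤ T → ‖F t - F s‖ ≤ K * (t - s) ^ (1 - α)) :
    MemW0 α (-r) T F := by
  refine ⟨(hF.comp continuous_subtype_val).measurable, ?_⟩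
  set B : ℝ≥0∞ := ENNReal.ofReal K * ENNReal.ofReal ((T + r) ^ (-2 * α + 1) / (-2 * α + 1)) with hB
  obtain ⟨M, hM⟩ := (isCompact_Icc (a := -r) (b := T)).exists_bound_of_continuousOn hF.continuousOn
  have hbound : normAlphaInf α (-r) T F ≤ ENNReal.ofReal M + (B + normAlphaInf α (-r) 0 F) := by
    refine iSup₂_le fun u hu => ?_
    rcases le_or_gt u 0 with hu0 | hu0
    · exact (le_normAlphaInf F ⟨hu.1, hu0⟩).trans (le_add_left (le_add_left le_rfl))
    -- For `v ≥ 0` the Hölder bound leaves `(u - v)^(-2α)`, integrable since `α < 1/2`. For `v < 0`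
    -- the increment is split at time `0`: the first piece obeys the same bound, and the second is
    -- controlled by the norm of the initial segment at time `0`, because `u - v ≥ 0 - v`.
    have hpt : ∀ v ∈ Ioo (-r) u, ‖F u - F v‖ₑ / ENNReal.ofReal ((u - v) ^ (α + 1)) ≤
        ENNReal.ofReal K * ENNReal.ofReal ((u - v) ^ (-2 * α)) + (Ioo (-r) 0).indicator
          (fun v => ‖F 0 - F v‖ₑ / ENNReal.ofReal ((0 - v) ^ (α + 1))) v := by
      intro v hv
      have huv : 0 < u - v := by linarith [hv.2]
      have hdiv : ∀ w, 0 ≤ w → w ≤ u → u - w ≤ u - v →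
          ‖F u - F w‖ₑ / ENNReal.ofReal ((u - v) ^ (α + 1)) ≤
            ENNReal.ofReal K * ENNReal.ofReal ((u - v) ^ (-2 * α)) := by
        intro w hw hwu hwv
        rw [← ofReal_norm, ← ENNReal.ofReal_div_of_pos (Real.rpow_pos_of_pos huv _),
          ← ENNReal.ofReal_mul hK]
        refine ENNReal.ofReal_le_ofReal ?_
        rw [div_le_iff₀ (Real.rpow_pos_of_pos huv _), mul_assoc, ← Real.rpow_add huv,
          show -2 * α + (α + 1) = 1 - α by ring]
        refine (hH w u hw hwu hu.2).trans ?_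
        gcongr
        linarith
      rcases lt_or_ge v 0 with hv0 | hv0
      · rw [indicator_of_mem (show v ∈ Ioo (-r) 0 from ⟨hv.1, hv0⟩)]
        have htri : ‖F u - F v‖ₑ ≤ ‖F u - F 0‖ₑ + ‖F 0 - F v‖ₑ := by
          rw [← sub_add_sub_cancel (F u) (F 0) (F v)]; exact enorm_add_le _ _
        calc _ ≤ (‖F u - F 0‖ₑ + ‖F 0 - F v‖ₑ) / ENNReal.ofReal ((u - v) ^ (α + 1)) := by gcongr
          _ = _ := ENNReal.add_div
          _ ≤ _ := by
            gcongr
            · exact hdiv 0 le_rfl hu0.le (by linarith)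
      · exact (hdiv v hv0 hv.2.le le_rfl).trans le_self_add
    gcongr
    · rw [← ofReal_norm]
      exact ENNReal.ofReal_le_ofReal (hM u hu)
    · refine (setLIntegral_mono' measurableSet_Ioo hpt).trans ?_
      rw [lintegral_add_left (by fun_prop)]
      gcongr
      · rw [lintegral_const_mul _ (by fun_prop), lintegral_Ioo_sub_rpow (by linarith) hu.1, hB]
        gcongr
        · linarith
        · linarith
        · linarith [hu.1]
        · linarith [hu.2]
      · rw [lintegral_indicator measurableSet_Ioo]
        refine (lintegral_mono' (Measure.restrict_mono_measure Measure.restrict_le_self _) le_rfl).trans ?_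
        exact le_add_self.trans (le_normAlphaInf (α := α) F (u := 0) ⟨by linarith, le_rfl⟩)
  refine hbound.trans_lt ?_
  have : B < ∞ := ENNReal.mul_lt_top ENNReal.ofReal_lt_top ENNReal.ofReal_lt_top
  exact ENNReal.add_lt_top.2 ⟨ENNReal.ofReal_lt_top, ENNReal.add_lt_top.2 ⟨this, hE⟩⟩

theorem abs_apply_le_frobenius {d m : ℕ} (A : Matrix (Fin d) (Fin m) ℝ) (i : Fin d) (j : Fin m) :
    |A i j| ≤ ‖A‖ := by
  rw [Matrix.frobenius_norm_def]
  have h1 : ‖A i j‖ ^ (2 : ℝ) ≤ ∑ i, ∑ j, ‖A i j‖ ^ (2 : ℝ) :=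
    (Finset.single_le_sum (f := fun j => ‖A i j‖ ^ (2 : ℝ)) (fun _ _ => by positivity)
      (Finset.mem_univ j)).trans
    (Finset.single_le_sum (f := fun i => ∑ j, ‖A i j‖ ^ (2 : ℝ))
      (fun _ _ => Finset.sum_nonneg fun _ _ => by positivity) (Finset.mem_univ i))
  calc |A i j| = (‖A i j‖ ^ (2 : ℝ)) ^ (1 / 2 : ℝ) := by
        rw [← Real.rpow_mul (norm_nonneg _)]; simp
    _ ≤ _ := Real.rpow_le_rpow (by positivity) h1 (by norm_num)

theorem MemWT.exists_bound {m : ℕ} {α T : ℝ} {g : ℝ → Vec m} (hg : MemWT α T g) :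
    ∃ C, 0 ≤ C ∧ ∀ j s t, 0 < s → s < t → t < T → |g t j - g s j| ≤ C * (t - s) ^ (1 - α) ∧
      ∫⁻ y in Ioo s t, ‖g y j - g s j‖ₑ / ENNReal.ofReal ((y - s) ^ (1 - α + 1)) ≤
        ENNReal.ofReal C := by
  refine ⟨(normOneSubAlphaInf α T g).toReal, ENNReal.toReal_nonneg, fun j s t hs hst ht => ?_⟩
  rw [ENNReal.ofReal_toReal hg.norm_lt_top.ne]
  have h : _ ≤ normOneSubAlphaInf α T g :=
    le_iSup₂_of_le s ⟨hs, hst.trans ht⟩ (le_iSup₂_of_le t ⟨hst, ht⟩ le_rfl)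
  have hp : 0 < (t - s) ^ (1 - α) := Real.rpow_pos_of_pos (by linarith) _
  constructor
  · have h1 := le_self_add.trans h
    rw [← ofReal_norm, ← ENNReal.ofReal_div_of_pos hp,
      ENNReal.ofReal_le_iff_le_toReal hg.norm_lt_top.ne, div_le_iff₀ hp] at h1
    exact (abs_apply_le_norm (g t - g s) j).trans h1
  · refine le_trans ?_ (le_add_self.trans h)
    refine setLIntegral_mono' measurableSet_Ioo fun y hy => ?_
    rw [show 1 - α + 1 = 2 - α by ring]
    gcongr
    rw [enorm_le_iff_norm_le]
    exact abs_apply_le_norm (g y - g s) j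

/-! ### The delayed coefficient and its integral against `g`. -/

section Coefficient

variable {d m : ℕ} {r T α β : ℝ} {σ : ℝ → Vec d → Matrix (Fin d) (Fin m) ℝ} {F : ℝ → Vec d}

/-- The Lipschitz bound in space transfers the fractional norm of `F`; the Hölder bound in time adds
the kernel `(x - y)^(β - α - 1)`, integrable because `α < β`. -/
theorem HypH1.exists_bound_comp (hσ : HypH1 T β σ) (hαβ : α < β) (hr : 0 < r)
    (hF : Continuous F) (hW : MemW0 α (-r) T F) :
    ContinuousOn (fun s => σ s (F (s - r))) (Icc 0 T) ∧ ∃ A, 0 ≤ A ∧ ∀ x, 0 < x → x ≤ T →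
      ‖σ x (F (x - r))‖ ≤ A ∧
      ∫⁻ y in Ioo 0 x, ‖σ x (F (x - r)) - σ y (F (y - r))‖ₑ / ENNReal.ofReal ((x - y) ^ (α + 1)) ≤
        ENNReal.ofReal A := by
  obtain ⟨M₀, hM₀, hlip, hhol⟩ := hσ.bounds
  have hβ := hσ.beta_pos
  have hdiff : ∀ s ∈ Icc 0 T, ∀ t ∈ Icc 0 T, ‖σ t (F (t - r)) - σ s (F (s - r))‖ ≤
      M₀ * |t - s| ^ β + M₀ * ‖F (t - r) - F (s - r)‖ := by
    intro s hs t ht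
    rw [← sub_add_sub_cancel (σ t (F (t - r))) (σ s (F (t - r)))]
    exact (norm_add_le _ _).trans (add_le_add (hhol t ht s hs _) (hlip s hs _ _))
  have hc : ContinuousOn (fun s => σ s (F (s - r))) (Icc 0 T) := by
    intro s hs
    refine tendsto_iff_norm_sub_tendsto_zero.2 ?_
    have hcont : Continuous fun t : ℝ => M₀ * |t - s| ^ β + M₀ * ‖F (t - r) - F (s - r)‖ := by
      have : Continuous fun t : ℝ => |t - s| ^ β :=
        (Real.continuous_rpow_const hβ.le).comp (by fun_prop : Continuous fun t : ℝ => |t - s|)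
      fun_prop
    have hlim := (hcont.tendsto s).mono_left (nhdsWithin_le_nhds (s := Icc 0 T))
    simp only [sub_self, abs_zero, Real.zero_rpow hβ.ne', norm_zero, mul_zero, add_zero] at hlim
    exact squeeze_zero' (Eventually.of_forall fun _ => norm_nonneg _)
      (eventually_mem_nhdsWithin.mono fun t ht => hdiff s hs t ht) hlim
  refine ⟨hc, ?_⟩
  obtain ⟨A₁, hA₁⟩ := isCompact_Icc.exists_bound_of_continuousOn hc
  set A₂ : ℝ≥0∞ := ENNReal.ofReal M₀ * ENNReal.ofReal (T ^ (β - (α + 1) + 1) / (β - (α + 1) + 1)) +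
    ENNReal.ofReal M₀ * normAlphaInf α (-r) T F with hA₂
  have hA₂top : A₂ ≠ ∞ := by
    refine ENNReal.add_ne_top.2 ⟨ENNReal.mul_ne_top ENNReal.ofReal_ne_top ENNReal.ofReal_ne_top,
      ENNReal.mul_ne_top ENNReal.ofReal_ne_top hW.norm_lt_top.ne⟩
  refine ⟨max A₁ A₂.toReal, le_max_of_le_right ENNReal.toReal_nonneg, fun x hx hxT =>
    ⟨(hA₁ x ⟨hx.le, hxT⟩).trans (le_max_left _ _), ?_⟩⟩
  refine le_trans ?_ (ENNReal.ofReal_le_ofReal (le_max_right _ _))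
  rw [ENNReal.ofReal_toReal hA₂top]
  -- Translation by `r` carries `(0,x)` to `(-r, x - r)`, exactly the domain of integration in the
  -- norm on `[-r,T]` at the point `x - r`.
  have hshift : ∫⁻ y in Ioo 0 x, ‖F (x - r) - F (y - r)‖ₑ / ENNReal.ofReal ((x - y) ^ (α + 1)) ≤
      normAlphaInf α (-r) T F := by
    refine le_trans (le_of_eq ?_) (le_add_self.trans
      (le_normAlphaInf (α := α) F (u := x - r) ⟨by linarith, by linarith⟩))
    have := (measurePreserving_sub_right volume r).setLIntegral_comp_preimage_emb
      (MeasurableEquiv.subRight r).measurableEmbedding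
      (fun v => ‖F (x - r) - F v‖ₑ / ENNReal.ofReal ((x - r - v) ^ (α + 1))) (Ioo (-r) (x - r))
    rw [← this]
    simp only [preimage_sub_const_Ioo, neg_add_cancel, sub_add_cancel, sub_sub_sub_cancel_right]
  have hpt : ∀ y ∈ Ioo 0 x, ‖σ x (F (x - r)) - σ y (F (y - r))‖ₑ / ENNReal.ofReal ((x - y) ^ (α + 1)) ≤
      ENNReal.ofReal M₀ * ENNReal.ofReal ((x - y) ^ (β - (α + 1))) +
      ENNReal.ofReal M₀ * (‖F (x - r) - F (y - r)‖ₑ / ENNReal.ofReal ((x - y) ^ (α + 1))) := by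
    intro y hy
    have hxy : 0 < x - y := by linarith [hy.2]
    have hp : 0 < (x - y) ^ (α + 1) := Real.rpow_pos_of_pos hxy _
    rw [← ofReal_norm (F (x - r) - F (y - r)), ← ofReal_norm, ← ENNReal.ofReal_div_of_pos hp,
      ← ENNReal.ofReal_div_of_pos hp, ← ENNReal.ofReal_mul hM₀.le, ← ENNReal.ofReal_mul hM₀.le,
      ← ENNReal.ofReal_add (by positivity) (by positivity)]
    refine ENNReal.ofReal_le_ofReal ?_
    have h := hdiff y ⟨hy.1.le, hy.2.le.trans hxT⟩ x ⟨hx.le, hxT⟩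
    rw [abs_of_pos hxy] at h
    rw [Real.rpow_sub hxy, mul_div_assoc', mul_div_assoc', ← add_div]
    gcongr
  refine (setLIntegral_mono' measurableSet_Ioo hpt).trans ?_
  rw [lintegral_add_left (by fun_prop), lintegral_const_mul _ (by fun_prop),
    lintegral_const_mul' _ _ ENNReal.ofReal_ne_top, lintegral_Ioo_sub_rpow (by linarith) hx.le,
    sub_zero, hA₂]
  have : 0 < β - (α + 1) + 1 := by linarith
  gcongr

variable {g : ℝ → Vec m}

theorem HypH1.exists_holder_fracStieltjesVec (hσ : HypH1 T β σ) (hα : 0 < α) (hα1 : α < 1)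
    (hαβ : α < β) (hr : 0 < r) (hT : 0 < T) (hF : Continuous F) (hW : MemW0 α (-r) T F)
    (hg : MemWT α T g) :
    ∃ D, 0 ≤ D ∧ ∀ s t, 0 ≤ s → s ≤ t → t ≤ T →
      ‖fracStieltjesVec α 0 t (fun s => σ s (F (s - r))) g -
        fracStieltjesVec α 0 s (fun s => σ s (F (s - r))) g‖ ≤ D * (t - s) ^ (1 - α) := by
  obtain ⟨hc, A, hA, hfA⟩ := hσ.exists_bound_comp hαβ hr hF hW
  obtain ⟨C, hC, hgC⟩ := hg.exists_bound
  have hD : ∀ i j, ∃ D, 0 ≤ D ∧ ∀ s t, 0 ≤ s → s ≤ t → t ≤ T →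
      |fracStieltjes α 0 t (fun s => σ s (F (s - r)) i j) (fun s => g s j) -
        fracStieltjes α 0 s (fun s => σ s (F (s - r)) i j) (fun s => g s j)| ≤
        D * (t - s) ^ (1 - α) := by
    intro i j
    refine exists_holder_fracStieltjes hα hα1 hT hA hC
      ((continuous_id.matrix_elem i j).comp_continuousOn hc)
      (fun x hx hxT => (abs_apply_le_frobenius _ i j).trans (hfA x hx hxT).1)
      (fun x hx hxT => le_trans ?_ (hfA x hx hxT).2)
      (fun s t hs hst ht => (hgC j s t hs hst ht).1) (fun s t hs hst ht => (hgC j s t hs hst ht).2)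
    refine setLIntegral_mono' measurableSet_Ioo fun y hy => ?_
    gcongr
    rw [enorm_le_iff_norm_le]
    exact abs_apply_le_frobenius (σ x (F (x - r)) - σ y (F (y - r))) i j
  choose D hD0 hD using hD
  refine ⟨d * ∑ i, ∑ j, D i j, mul_nonneg (Nat.cast_nonneg _)
    (Finset.sum_nonneg fun i _ => Finset.sum_nonneg fun j _ => hD0 i j), fun s t hs hst ht => ?_⟩
  rw [mul_assoc]
  refine norm_le_card_mul fun i => ?_
  have hp : 0 ≤ (t - s) ^ (1 - α) := Real.rpow_nonneg (by linarith) _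
  simp only [fracStieltjesVec, PiLp.sub_apply, ← Finset.sum_sub_distrib]
  calc _ ≤ _ := Finset.abs_sum_le_sum_abs _ _
    _ ≤ ∑ j, D i j * (t - s) ^ (1 - α) := Finset.sum_le_sum fun j _ => hD i j s t hs hst ht
    _ = (∑ j, D i j) * (t - s) ^ (1 - α) := (Finset.sum_mul _ _ _).symm
    _ ≤ _ := mul_le_mul_of_nonneg_right (Finset.single_le_sum (f := fun i => ∑ j, D i j)
      (fun i _ => Finset.sum_nonneg fun j _ => hD0 i j) (Finset.mem_univ i)) hp

end Coefficient

/-! ### Freezing the delayed path. -/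

section Delay

variable {d m : ℕ} {r T α β : ℝ} {σ : ℝ → Vec d → Matrix (Fin d) (Fin m) ℝ} {g : ℝ → Vec m}
  {b : ℝ → PathSpace (-r) T d → Vec d} {η : ℝ → Vec d}

/-- The forcing `∫_0^t σ(s, x(s - r)) dg_s`. -/
def delayForcing (hrT : -r ≤ T) (α : ℝ) (σ : ℝ → Vec d → Matrix (Fin d) (Fin m) ℝ) (g : ℝ → Vec m)
    (x : PathSpace (-r) T d) (t : ℝ) : Vec d :=
  fracStieltjesVec α 0 t (fun s => σ s (IccExtend hrT x (s - r))) g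

theorem delayForcing_zero (hrT : -r ≤ T) (x : PathSpace (-r) T d) :
    delayForcing hrT α σ g x 0 = 0 := by
  ext i
  simp [delayForcing, fracStieltjesVec, fracStieltjes]

/-- Presents solutions as fixed points of the frozen problem: the path driving the forcing is the
path being solved for. -/
theorem isReflectedDelaySolution_iff (hrT : -r ≤ T) (x : PathSpace (-r) T d) :
    IsReflectedDelaySolution hrT α σ b g η x ↔
      IsReflectedImage b η (delayForcing hrT α σ g x) x x :=
  ⟨fun h => ⟨h.1, h.2⟩, fun h => ⟨h.1, h.2⟩⟩

/-- The gain of `r` in time that drives the induction: for `s < t ≤ τ + r` the integrand looks at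
the path only at `s - r < τ`. -/
theorem delayForcing_congr (hrT : -r ≤ T) {x x' : PathSpace (-r) T d} {τ t : ℝ}
    (hx : ∀ s : Icc (-r) T, (s : ℝ) ≤ τ → x s = x' s) (ht : 0 ≤ t) (htT : t - r ≤ T)
    (htτ : t ≤ τ + r) : delayForcing hrT α σ g x t = delayForcing hrT α σ g x' t := by
  ext i
  simp only [delayForcing, fracStieltjesVec]
  refine Finset.sum_congr rfl fun j _ => fracStieltjes_congr_left ht fun s hs => ?_
  have hmem : s - r ∈ Icc (-r) T := ⟨by linarith [hs.1], by linarith [hs.2]⟩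
  rw [IccExtend_of_mem hrT x hmem, IccExtend_of_mem hrT x' hmem, hx ⟨s - r, hmem⟩]
  simp only
  linarith [hs.2]

theorem memW0_IccExtend (hrT : -r ≤ T) (hα : 0 < α) (hα2 : α < 1 / 2) (hr : 0 < r) (hT : 0 < T)
    (hη : MemW0 α (-r) 0 η) {x : PathSpace (-r) T d} (hx : ∀ t : Icc (-r) T, (t : ℝ) ≤ 0 → x t = η t)
    (hH : ∃ K, 0 ≤ K ∧ ∀ s t : Icc (-r) T, 0 ≤ (s : ℝ) → (s : ℝ) ≤ t →
      ‖x t - x s‖ ≤ K * ((t : ℝ) - s) ^ (1 - α)) : MemW0 α (-r) T (IccExtend hrT x) := by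
  obtain ⟨K, hK, hH⟩ := hH
  have hext : ∀ t, t ∈ Icc (-r) 0 → IccExtend hrT x t = η t := fun t ht => by
    rw [IccExtend_of_mem hrT x ⟨ht.1, ht.2.trans hT.le⟩]
    exact hx _ ht.2
  refine memW0_of_holder hα hα2 hr (x.continuous.Icc_extend') ?_ hK ?_
  · convert hη.norm_lt_top using 1
    refine iSup_congr fun u => iSup_congr fun hu => ?_
    rw [hext u hu]
    congr 1
    refine setLIntegral_congr_fun measurableSet_Ioo fun v hv => ?_
    rw [hext v ⟨hv.1.le, hv.2.le.trans hu.2⟩]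
  · intro s t hs hst ht
    have hs' : s ∈ Icc (-r) T := ⟨by linarith, hst.trans ht⟩
    have ht' : t ∈ Icc (-r) T := ⟨by linarith, ht⟩
    rw [IccExtend_of_mem hrT x hs', IccExtend_of_mem hrT x ht']
    exact hH ⟨s, hs'⟩ ⟨t, ht'⟩ hs hst

/-- With the delayed path frozen at `x`, the reflected equation has a solution in
`W_0^{α,∞}(-r,T)`. -/
theorem exists_solution_of_frozen_delay (hrT : -r ≤ T) (hr : 0 < r) (hT : 0 < T) (hα : 0 < α)
    (hα2 : α < 1 / 2) (hαβ : α < β) (hσ : HypH1 T β σ) (hb : HypH2 r T (1 / α) b)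
    (hg : MemWT α T g) (hη : MemW0 α (-r) 0 η) (hηc : ContinuousOn η (Icc (-r) 0))
    (hη0 : ∀ i, 0 ≤ η 0 i) {x : PathSpace (-r) T d} (hx : MemW0 α (-r) T (IccExtend hrT x)) :
    ∃ x', IsReflectedImage b η (delayForcing hrT α σ g x) x' x' ∧
      MemW0 α (-r) T (IccExtend hrT x') := by
  obtain ⟨D, hD, hH⟩ := hσ.exists_holder_fracStieltjesVec hα (by linarith) hαβ hr hT
    (x.continuous.Icc_extend') hx hg
  have hc : ContinuousOn (delayForcing hrT α σ g x) (Icc 0 T) := by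
    have hb : ∀ s ∈ Icc 0 T, ∀ t ∈ Icc 0 T, dist (delayForcing hrT α σ g x t)
        (delayForcing hrT α σ g x s) ≤ D * |t - s| ^ (1 - α) := by
      intro s hs t ht
      rcases le_total s t with h | h
      · rw [dist_eq_norm, abs_of_nonneg (by linarith)]; exact hH s t hs.1 h ht.2
      · rw [dist_comm, dist_eq_norm, abs_sub_comm, abs_of_nonneg (by linarith)]
        exact hH t s ht.1 h hs.2
    intro s hs
    refine tendsto_iff_dist_tendsto_zero.2 ?_
    have hcont : Continuous fun t : ℝ => D * |t - s| ^ (1 - α) :=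
      continuous_const.mul ((Real.continuous_rpow_const (by linarith)).comp
        (by fun_prop : Continuous fun t : ℝ => |t - s|))
    have hlim := (hcont.tendsto s).mono_left (nhdsWithin_le_nhds (s := Icc 0 T))
    rw [sub_self, abs_zero, Real.zero_rpow (by linarith), mul_zero] at hlim
    exact squeeze_zero' (Eventually.of_forall fun _ => dist_nonneg)
      (eventually_mem_nhdsWithin.mono fun t ht => hb s hs t ht) hlim
  obtain ⟨x', hx'⟩ := hb.exists_isReflectedImage_self hr hT hηc hη0 hc (delayForcing_zero hrT x)
  exact ⟨x', hx', memW0_IccExtend hrT hα hα2 hr hT hη hx'.initial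
    (hx'.exists_holder hα (by linarith) hb hT hη0 (delayForcing_zero hrT x) hD hH)⟩

end Delay

end

/-! ### Existence and uniqueness by steps of length `r`. -/

theorem mainTheorem2 {d m : ℕ} {r T α β : ℝ} (hr : 0 < r) (hT : 0 < T)
    (hα : 0 < α) (hαβ : α < min (1 / 2) β)
    (σ : ℝ → Vec d → Matrix (Fin d) (Fin m) ℝ) (hσ : HypH1 T β σ)
    (b : ℝ → PathSpace (-r) T d → Vec d) (hb : HypH2 r T (1 / α) b)
    (g : ℝ → Vec m) (hg : MemWT α T g)
    (η : ℝ → Vec d) (hη : MemW0 α (-r) 0 η) (hη_cont : ContinuousOn η (Icc (-r) 0))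
    (hη_nonneg : ∀ t ∈ Icc (-r) 0, ∀ i, 0 ≤ η t i) :
    ∃! x : PathSpace (-r) T d,
      MemW0 α (-r) T (IccExtend ((neg_lt_zero.mpr hr).trans hT).le x) ∧
      (∀ t i, 0 ≤ x t i) ∧
      IsReflectedDelaySolution ((neg_lt_zero.mpr hr).trans hT).le α σ b g η x := by
  have hrT : -r ≤ T := ((neg_lt_zero.mpr hr).trans hT).le
  obtain ⟨hα2, hαβ'⟩ := lt_min_iff.1 hαβ
  have hη0 : ∀ i, 0 ≤ η 0 i := hη_nonneg 0 ⟨by linarith, le_rfl⟩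
  have hstep := fun x => exists_solution_of_frozen_delay (x := x) hrT hr hT hα hα2 hαβ' hσ hb hg hη
    hη_cont hη0
  have hτ : ∀ n : ℕ, min (n * r) T ∈ Icc 0 T := fun n => ⟨le_min (by positivity) hT.le, min_le_right _ _⟩
  have hforce : ∀ (n : ℕ) (x x' : PathSpace (-r) T d),
      (∀ t : Icc (-r) T, (t : ℝ) ≤ min (n * r) T → x t = x' t) →
      ∀ t ∈ Icc 0 (min ((n + 1 : ℕ) * r) T),
        delayForcing hrT α σ g x t = delayForcing hrT α σ g x' t := by
    intro n x x' h t ht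
    have h1 := ht.2.trans (min_le_left _ _)
    have h2 := ht.2.trans (min_le_right _ _)
    push_cast at h1
    refine delayForcing_congr hrT h ht.1 (by linarith) ?_
    rw [← sub_le_iff_le_add]
    exact le_min (by linarith) (by linarith)
  obtain ⟨N, hN⟩ := exists_nat_ge (T / r)
  rw [div_le_iff₀ hr] at hN
  -- `x` is the `n`-th frozen path and `x'` the solution it produces; each round extends their
  -- agreement by `r`.
  have hiter : ∀ n : ℕ, ∃ x x' : PathSpace (-r) T d, MemW0 α (-r) T (IccExtend hrT x) ∧
      MemW0 α (-r) T (IccExtend hrT x') ∧ IsReflectedImage b η (delayForcing hrT α σ g x) x' x' ∧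
      ∀ t : Icc (-r) T, (t : ℝ) ≤ min (n * r) T → x t = x' t := by
    intro n
    induction n with
    | zero =>
      -- The starting path is `η` continued by the constant `η 0`, which is Hölder on `[0,T]` with
      -- constant `0`.
      have hc : Continuous fun t : Icc (-r) T => η (min (t : ℝ) 0) :=
        hη_cont.comp_continuous (by fun_prop) fun t => ⟨le_min t.2.1 (by linarith), min_le_right _ _⟩
      have hx : MemW0 α (-r) T (IccExtend hrT (⟨_, hc⟩ : PathSpace (-r) T d)) := by
        refine memW0_IccExtend hrT hα hα2 hr hT hη (fun t ht => by simp [min_eq_left ht])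
          ⟨0, le_rfl, fun s t hs hst => ?_⟩
        simp [min_eq_right hs, min_eq_right (hs.trans hst)]
      obtain ⟨x', hx', hW⟩ := hstep _ hx
      refine ⟨_, x', hx, hW, hx', fun t ht => ?_⟩
      have ht0 : (t : ℝ) ≤ 0 := ht.trans ((min_le_left _ _).trans (by simp))
      rw [hx'.initial t ht0]
      simp [min_eq_left ht0]
    | succ n ih =>
      obtain ⟨x, x', -, hW', hx', heq⟩ := ih
      obtain ⟨x'', hx'', hW''⟩ := hstep _ hW'
      exact ⟨x', x'', hW', hW'', hx'', fun t ht =>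
        hx'.eq_of_forcing_eq hb hx'' (hτ (n + 1)) (hforce n x x' heq) t ht⟩
  obtain ⟨x, x', hW, -, hx', heq⟩ := hiter N
  -- Since `N * r ≥ T`, agreement now covers the whole interval, so the frozen path solves its own
  -- equation.
  obtain rfl : x = x' := by
    ext1 t
    exact heq t (t.2.2.trans (le_min hN le_rfl))
  refine ⟨x, ⟨hW, fun t i => ?_, (isReflectedDelaySolution_iff hrT x).2 hx'⟩, ?_⟩
  · rcases le_or_gt (t : ℝ) 0 with ht | ht
    · rw [hx'.initial t ht]
      exact hη_nonneg t ⟨t.2.1, ht⟩ i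
    · obtain ⟨y, hy, hxy⟩ := hx'.equation
      rw [hxy t ht]
      exact hy.add_nonneg ⟨ht.le, t.2.2⟩ i
  · rintro u ⟨-, -, hu⟩
    rw [isReflectedDelaySolution_iff] at hu
    have hind : ∀ n : ℕ, ∀ t : Icc (-r) T, (t : ℝ) ≤ min (n * r) T → u t = x t := by
      intro n
      induction n with
      | zero =>
        intro t ht
        have ht0 : (t : ℝ) ≤ 0 := ht.trans ((min_le_left _ _).trans (by simp))
        rw [hu.initial t ht0, hx'.initial t ht0]
      | succ n ih =>
        intro t ht
        exact hu.eq_of_forcing_eq hb hx' (hτ (n + 1)) (hforce n u x ih) t ht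
    ext1 t
    exact hind N t (t.2.2.trans (le_min hN le_rfl))
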